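/- Let $n\ge 1$ be an integer. On $\mathbb C^n$, with coordinates $z_j=x_j+iy_j$, put $\frac{\partial}{\partial z_j}=\frac12(\partial_{x_j}-i\partial_{y_j})$, $\frac{\partial}{\partial \bar z_j}=\frac12(\partial_{x_j}+i\partial_{y_j})$, $Z_j=\frac{\partial}{\partial z_j}+\frac12\bar z_j$, $\bar Z_j=-\frac{\partial}{\partial\bar z_j}+\frac12 z_j$, and let $$\mathcal L=\sum_{j=1}^n (Z_j\bar Z_j+\bar Z_jZ_j)$$ be the twisted Laplacian (Landau Hamiltonian), realised as a self-adjoint operator in $L^2(\mathbb C^n)$ with domain $\{u\in L^2(\mathbb C^n):\mathcal Lu\in L^2(\mathbb C^n)\}$, where $\mathcal L u$ is taken in the sense of distributions. For an eigenvalue $\mu$ of $\mathcal L$ let $P_\mu$ be the orthogonal projection of $L^2(\mathbb C^n)$ onto the eigenspace $\ker(\mathcal L-\mu)$, and let $\mathcal L^{1/2}u=\sum_\mu \sqrt\mu\,P_\mu u$, with domain the set of all $u\in L^2(\mathbb C^n)$ for which this series, over the eigenvalues $\mu$ of $\mathcal L$, converges in $L^2(\mathbb C^n)$. For real $p\ge1$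 and $\theta\in[0,1]$ consider the inequality $$\|u\|_{L^{2p}(\mathbb C^n)}\le C\,\|\mathcal L^{1/2}u\|_{L^2(\mathbb C^n)}^{\theta}\,\|u\|_{L^2(\mathbb C^n)}^{1-\theta}\qquad\text{for all } u \text{ in the domain of } \mathcal L^{1/2}, \tag{1}$$ with a constant $C>0$ independent of $u$ (in particular, every such $u$ is in $L^{2p}(\mathbb C^n)$). Call $p\ge 1$ Gagliardo–Nirenberg admissible for $\mathcal L$ if (1) holds for some $\theta\in[0,1]$ and some $C>0$. Then: 1. The Gagliardo–Nirenberg admissible indices for $\mathcal L$ are exactly $$1\le p<\infty\ \text{ if } n=1,\qquad 1\le p\le \frac{n}{n-1}\ \text{ if } n\ge2.$$ 2. For each of these $p$, inequality (1) holds with $\theta=\frac{n(p-1)}{p}$. 3. The smallest eigenvalue of $\mathcal L$ is $\lambda_0=n$. The spectrum of $\mathcal L$ is discrete, in the sense that every interval $(-\infty,R]$ contains only finitely many eigenvalues and that $L^2(\mathbb C^n)$ has an orthonormal basis $(e_k)_{k\in\mathbb N}$ of eigenvectors of $\mathcal L$. Every eigenvalue has infinite multiplicity. -/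

import Mathlib

open MeasureTheory
open scoped ContDiff ComplexConjugate

noncomputable section

namespace Landau

variable {n : ℕ}

/-- The Wirtinger derivative `∂/∂z_j = (∂/∂x_j - i ∂/∂y_j)/2` on `ℂⁿ`, where `z_j = x_j + i y_j`. -/
def dz (j : Fin n) (f : (Fin n → ℂ) → ℂ) (z : Fin n → ℂ) : ℂ :=
  (1 / 2) * (fderiv ℝ f z (Pi.single j 1) - Complex.I * fderiv ℝ f z (Pi.single j Complex.I))

/-- The Wirtinger derivative `∂/∂z̄_j = (∂/∂x_j + i ∂/∂y_j)/2` on `ℂⁿ`. -/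
def dzbar (j : Fin n) (f : (Fin n → ℂ) → ℂ) (z : Fin n → ℂ) : ℂ :=
  (1 / 2) * (fderiv ℝ f z (Pi.single j 1) + Complex.I * fderiv ℝ f z (Pi.single j Complex.I))

/-- `Z_j = ∂/∂z_j + z̄_j / 2`. -/
def Z (j : Fin n) (f : (Fin n → ℂ) → ℂ) (z : Fin n → ℂ) : ℂ :=
  dz j f z + (1 / 2) * conj (z j) * f z

/-- `Z̄_j = -∂/∂z̄_j + z_j / 2`. -/
def Zbar (j : Fin n) (f : (Fin n → ℂ) → ℂ) (z : Fin n → ℂ) : ℂ :=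
  -dzbar j f z + (1 / 2) * z j * f z

/-- The differential expression `ℒ = ∑_j (Z_j Z̄_j + Z̄_j Z_j)` of the twisted Laplacian
(Landau Hamiltonian), acting on smooth functions. -/
def twistedLaplacian (f : (Fin n → ℂ) → ℂ) (z : Fin n → ℂ) : ℂ :=
  ∑ j : Fin n, (Z j (Zbar j f) z + Zbar j (Z j f) z)

/-- Test functions: smooth (over `ℝ`) and compactly supported functions on `ℂⁿ`. -/
def IsTest (φ : (Fin n → ℂ) → ℂ) : Prop :=
  ContDiff ℝ ∞ φ ∧ HasCompactSupport φ

lemma IsTest.fderiv_apply {φ : (Fin n → ℂ) → ℂ} (h : IsTest φ) (v : Fin n → ℂ) :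
    IsTest (fun z => fderiv ℝ φ z v) := by
  refine ⟨(h.1.fderiv_right (m := ∞) (by simp)).clm_apply contDiff_const, ?_⟩
  exact h.2.fderiv_apply (𝕜 := ℝ) v

lemma IsTest.add {φ ψ : (Fin n → ℂ) → ℂ} (h : IsTest φ) (k : IsTest ψ) :
    IsTest (fun z => φ z + ψ z) :=
  ⟨h.1.add k.1, h.2.add k.2⟩

lemma IsTest.mul_left {φ g : (Fin n → ℂ) → ℂ} (h : IsTest φ) (hg : ContDiff ℝ ∞ g) :
    IsTest (fun z => g z * φ z) :=
  ⟨hg.mul h.1, h.2.mul_left⟩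

lemma contDiff_coord (j : Fin n) : ContDiff ℝ ∞ (fun z : Fin n → ℂ => z j) :=
  contDiff_apply ℝ ℂ j

lemma contDiff_conj_coord (j : Fin n) : ContDiff ℝ ∞ (fun z : Fin n → ℂ => conj (z j)) :=
  Complex.conjCLE.contDiff.comp (contDiff_coord j)

lemma IsTest.Z {φ : (Fin n → ℂ) → ℂ} (h : IsTest φ) (j : Fin n) : IsTest (Z j φ) := by
  have h1 := (((h.fderiv_apply (Pi.single j 1)).add
    ((h.fderiv_apply (Pi.single j Complex.I)).mul_left
      (contDiff_const (c := -Complex.I)))).mul_left (contDiff_const (c := (1 / 2 : ℂ)))).add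
    (h.mul_left ((contDiff_const (c := (1 / 2 : ℂ))).mul (contDiff_conj_coord j)))
  convert h1 using 2 with z
  simp only [Landau.Z, dz]
  ring

lemma IsTest.Zbar {φ : (Fin n → ℂ) → ℂ} (h : IsTest φ) (j : Fin n) : IsTest (Zbar j φ) := by
  have h1 := (((h.fderiv_apply (Pi.single j 1)).add
    ((h.fderiv_apply (Pi.single j Complex.I)).mul_left
      (contDiff_const (c := Complex.I)))).mul_left (contDiff_const (c := (-(1 / 2) : ℂ)))).add
    (h.mul_left ((contDiff_const (c := (1 / 2 : ℂ))).mul (contDiff_coord j)))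
  convert h1 using 2 with z
  simp only [Landau.Zbar, dzbar]
  ring

lemma IsTest.twistedLaplacian {φ : (Fin n → ℂ) → ℂ} (h : IsTest φ) :
    IsTest (twistedLaplacian φ) := by
  have key : ∀ s : Finset (Fin n), IsTest
      (fun z => ∑ j ∈ s, (Landau.Z j (Landau.Zbar j φ) z + Landau.Zbar j (Landau.Z j φ) z)) := by
    intro s
    induction s using Finset.induction_on with
    | empty =>
      simp only [Finset.sum_empty]
      exact ⟨contDiff_const, HasCompactSupport.zero⟩
    | insert a s ha ih =>
      simp only [Finset.sum_insert ha]
      exact (((h.Zbar a).Z a).add ((h.Z a).Zbar a)).add ih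
  exact key Finset.univ

lemma IsTest.memLp {φ : (Fin n → ℂ) → ℂ} (h : IsTest φ) : MemLp φ 2 volume :=
  h.1.continuous.memLp_of_hasCompactSupport h.2

variable (n) in
/-- The Hilbert space `L²(ℂⁿ)` with respect to Lebesgue measure. -/
abbrev L2 : Type := Lp ℂ 2 (volume : Measure (Fin n → ℂ))

/-- `HasImage u f` says that `u ∈ L²` lies in the domain of the Landau Hamiltonian, realised as
a self-adjoint operator of `L²(ℂⁿ)`, and that `ℒ u = f`. The expression `ℒ` is formally symmetric,
and the realisation is the adjoint of `ℒ` on the test functions: `⟨ℒ φ, u⟩ = ⟨φ, f⟩` for every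
test function `φ`, that is, `ℒ u = f` in the sense of distributions. -/
def HasImage (u f : L2 n) : Prop :=
  ∀ φ : (Fin n → ℂ) → ℂ, IsTest φ →
    ∫ z, conj (twistedLaplacian φ z) * u z = ∫ z, conj (φ z) * f z

lemma IsTest.integral_eq_inner {φ : (Fin n → ℂ) → ℂ} (h : IsTest φ) (u : L2 n) :
    ∫ z, conj (φ z) * u z = inner ℂ (h.memLp.toLp φ) u := by
  rw [L2.inner_def]
  refine integral_congr_ae ?_
  filter_upwards [h.memLp.coeFn_toLp] with z hz
  rw [hz, RCLike.inner_apply, mul_comm]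

lemma hasImage_iff (u f : L2 n) : HasImage u f ↔ ∀ φ : (Fin n → ℂ) → ℂ, ∀ h : IsTest φ,
    inner ℂ (h.twistedLaplacian.memLp.toLp _) u = inner ℂ (h.memLp.toLp φ) f := by
  refine forall_congr' fun φ => forall_congr' fun h => ?_
  rw [h.integral_eq_inner, h.twistedLaplacian.integral_eq_inner]

/-- The eigenspace `{u ∈ L²(ℂⁿ) : ℒ u = μ u}`. -/
def eigenspace (n : ℕ) (μ : ℝ) : Submodule ℂ (L2 n) where
  carrier := {u | HasImage u ((μ : ℂ) • u)}
  zero_mem' := by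
    simp only [Set.mem_ofPred_eq, hasImage_iff]
    intro φ h
    simp
  add_mem' := by
    intro u v hu hv
    simp only [Set.mem_ofPred_eq, hasImage_iff] at hu hv ⊢
    intro φ h
    rw [smul_add, inner_add_right, inner_add_right, hu φ h, hv φ h]
  smul_mem' := by
    intro c u hu
    simp only [Set.mem_ofPred_eq, hasImage_iff] at hu ⊢
    intro φ h
    rw [smul_comm, inner_smul_right, inner_smul_right, hu φ h]

lemma isClosed_eigenspace (n : ℕ) (μ : ℝ) : IsClosed (eigenspace n μ : Set (L2 n)) := by
  have : (eigenspace n μ : Set (L2 n)) = ⋂ φ : (Fin n → ℂ) → ℂ, ⋂ h : IsTest φ,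
      {u | inner ℂ (h.twistedLaplacian.memLp.toLp _) u
        = inner ℂ (h.memLp.toLp φ) ((μ : ℂ) • u)} := by
    ext u
    simp only [Set.mem_iInter]
    exact hasImage_iff u _
  rw [this]
  exact isClosed_iInter fun φ => isClosed_iInter fun h =>
    isClosed_eq (by fun_prop) (by fun_prop)

instance (n : ℕ) (μ : ℝ) : CompleteSpace (eigenspace n μ) :=
  (isClosed_eigenspace n μ).completeSpace_coe

/-- The set of eigenvalues of `ℒ`. -/
def eigenvalues (n : ℕ) : Set ℝ := {μ | eigenspace n μ ≠ ⊥}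

/-- `HasSqrtImage u v` says that `u ∈ L²` lies in the domain of `ℒ^{1/2}` and `ℒ^{1/2} u = v`:
`v` is the sum in `L²` of the series `∑_μ √μ P_μ u` over the eigenvalues `μ` of `ℒ`,
where `P_μ` is the orthogonal projection onto the eigenspace of `μ`. -/
def HasSqrtImage (u v : L2 n) : Prop :=
  HasSum (fun μ : eigenvalues n => ((√(μ : ℝ) : ℝ) : ℂ) • (eigenspace n μ).starProjection u) v

/-- The Gagliardo–Nirenberg inequality `‖u‖_{2p} ≤ C ‖ℒ^{1/2} u‖_2^θ ‖u‖_2^{1-θ}` for all `u` in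
the domain of `ℒ^{1/2}`, with a constant `C` independent of `u`; it includes that
`u ∈ L^{2p}(ℂⁿ)`. -/
def GNInequality (n : ℕ) (p θ : ℝ) : Prop :=
  ∃ C : ℝ, 0 < C ∧ ∀ u v : L2 n, HasSqrtImage u v →
    eLpNorm u (ENNReal.ofReal (2 * p)) volume ≤ ENNReal.ofReal (C * ‖v‖ ^ θ * ‖u‖ ^ (1 - θ))

/-- `p ≥ 1` is Gagliardo–Nirenberg admissible for `ℒ` if the inequality holds for some
`θ ∈ [0, 1]`. -/
def GNAdmissible (n : ℕ) (p : ℝ) : Prop :=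
  1 ≤ p ∧ ∃ θ : ℝ, 0 ≤ θ ∧ θ ≤ 1 ∧ GNInequality n p θ

end Landau

end

/-! The spectral part is ladder algebra. Besides `Z_j`, `Z̄_j` (the modes `inl j`) there is a second
family of creation and annihilation operators (the modes `inr j`) that commutes with the first and
is absent from `ℒ`. The canonical commutation relations (`ann_cre`, `cre_comm`), adjointness by
integration by parts (`inner_cre`) and a Gaussian killed by every annihilation operator give
orthogonal Schwartz eigenfunctions `excited s`, indexed by multisets of modes, with eigenvalue `n +
2 · #(inl modes in s)`. They are complete (`eq_zero_of_inner_excited`): their span contains all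
powers of real linear forms times the Gaussian, so if `u` is orthogonal to it, the Fourier transform
of Gaussian times `u` vanishes. The weak equation may be tested on Schwartz functions
(`hasImage_iff_schwartz`), hence on this basis, so `ℒ` and `ℒ^{1/2}` are diagonal in it. The `inr`
modes cost no energy, whence the infinite multiplicity.

The inequality rests on a diamagnetic estimate: `∂f` differs from a combination of `Z_j f`, `Z̄_j f`
by an imaginary multiple of `f`, which does not change `|f|`. The `L¹` Sobolev inequality for
`|f|^s` and Cauchy–Schwarz then bound a power integral of `f` by a lower one and the form norm
(`exists_powInt_le`). For `n ≥ 2` one choice of `s` closes at the critical exponent; for `n = 1`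
iteration reaches every integer. Hölder interpolation with `L²` fills in the other exponents.
Cutoffs pass from compact support to Schwartz functions, and finite partial sums of the
eigenfunction expansion, with Bessel's and Fatou's inequalities, to the whole form domain.

For necessity when `n ≥ 2`, take Gaussians `exp (-a|z|²)` with `a → ∞`: the `L^{2p}` norm is of
order `a^{-n/(2p)}`, the `L²` norm of order `a^{-n/2}`, the form norm `O(a^{(1-n)/2})`. Hence `n - θ
≤ n/p`, and `θ ≤ 1` gives the bound on `p`. -/

open Filter Topology
open scoped SchwartzMap

noncomputable section

namespace Landau

variable {n : ℕ}

/-! ### Gaussians as Schwartz functions. -/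

section Gaussian

variable {E : Type*} [NormedAddCommGroup E] [NormedSpace ℝ E]

/-- A rapidly decreasing function whose logarithmic derivative has temperate growth has rapidly
decreasing derivatives of every order. -/
theorem decay_of_fderiv_eq_smul {g : E → ℂ} {A : E → E →L[ℝ] ℂ}
    (hA : Function.HasTemperateGrowth A) (hg : ContDiff ℝ ∞ g)
    (hd : ∀ x, fderiv ℝ g x = g x • A x) (h0 : ∀ k : ℕ, ∃ C : ℝ, ∀ x, ‖x‖ ^ k * ‖g x‖ ≤ C)
    (m k : ℕ) : ∃ C : ℝ, ∀ x, ‖x‖ ^ k * ‖iteratedFDeriv ℝ m g x‖ ≤ C := by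
  induction m using Nat.strong_induction_on generalizing k with
  | _ m ih =>
    rcases m with _ | m
    · simpa using h0 k
    · obtain ⟨N, C, hC0, hC⟩ := hA.norm_iteratedFDeriv_le_uniform m
      have hd' : fderiv ℝ g = fun x => g x • A x := funext hd
      choose! D hD using ih
      refine ⟨∑ i ∈ Finset.range (m + 1), (m.choose i : ℝ) *
        (C * (2 ^ (N - 1) * (D i k + D i (k + N)))), fun x => ?_⟩
      rw [← norm_iteratedFDeriv_fderiv, hd']
      have h1 := norm_iteratedFDeriv_smul_le (𝕜 := ℝ) (f := g) (g := A) hg hA.1 x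
        (n := m) (mod_cast le_top)
      calc ‖x‖ ^ k * ‖iteratedFDeriv ℝ m (fun x => g x • A x) x‖
          ≤ ‖x‖ ^ k * ∑ i ∈ Finset.range (m + 1), (m.choose i : ℝ) *
            ‖iteratedFDeriv ℝ i g x‖ * ‖iteratedFDeriv ℝ (m - i) A x‖ := by gcongr
        _ ≤ _ := by
            rw [Finset.mul_sum]
            refine Finset.sum_le_sum fun i hi => ?_
            have hi' : i < m + 1 := Finset.mem_range.1 hi
            have h2 := hC (m - i) (Nat.sub_le _ _) x
            have h3 := hD i hi' k x
            have h4 := hD i hi' (k + N) x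
            -- Convexity of the power trades the temperate growth of `A` for the decay bounds of
            -- orders `k` and `k + N`. The truncated `N - 1` is harmless at `N = 0`.
            have h5 : (1 + ‖x‖) ^ N ≤ 2 ^ (N - 1) * (1 ^ N + ‖x‖ ^ N) :=
              add_pow_le zero_le_one (norm_nonneg _) N
            rw [one_pow] at h5
            calc ‖x‖ ^ k * ((m.choose i : ℝ) * ‖iteratedFDeriv ℝ i g x‖ *
                  ‖iteratedFDeriv ℝ (m - i) A x‖)
                ≤ ‖x‖ ^ k * ((m.choose i : ℝ) * ‖iteratedFDeriv ℝ i g x‖ *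
                  (C * (2 ^ (N - 1) * (1 + ‖x‖ ^ N)))) := by
                    gcongr
                    exact h2.trans (by gcongr)
              _ = (m.choose i : ℝ) * (C * (2 ^ (N - 1) *
                  (‖x‖ ^ k * ‖iteratedFDeriv ℝ i g x‖ +
                    ‖x‖ ^ (k + N) * ‖iteratedFDeriv ℝ i g x‖))) := by ring
              _ ≤ _ := by gcongr

end Gaussian

/-- The Euclidean square `|z|² = ∑ |z_j|²`. -/
def absSq (z : Fin n → ℂ) : ℝ := ∑ j, ‖z j‖ ^ 2

lemma absSq_nonneg (z : Fin n → ℂ) : 0 ≤ absSq z := Finset.sum_nonneg fun _ _ => by positivity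

lemma norm_sq_le_absSq (z : Fin n → ℂ) : ‖z‖ ^ 2 ≤ absSq z := by
  have h : ‖z‖ ≤ √(absSq z) := by
    refine (pi_norm_le_iff_of_nonneg (Real.sqrt_nonneg _)).2 fun j => ?_
    refine Real.le_sqrt_of_sq_le ?_
    exact Finset.single_le_sum (f := fun j => ‖z j‖ ^ 2) (fun _ _ => by positivity)
      (Finset.mem_univ j)
  calc ‖z‖ ^ 2 ≤ √(absSq z) ^ 2 := by gcongr
    _ = absSq z := Real.sq_sqrt (absSq_nonneg z)

/-- The derivative of `absSq`. -/
def absSqDeriv (n : ℕ) : (Fin n → ℂ) →L[ℝ] (Fin n → ℂ) →L[ℝ] ℝ :=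
  ∑ j, (2 : ℝ) • (((ContinuousLinearMap.compL ℝ (Fin n → ℂ) ℂ ℝ).flip
    (ContinuousLinearMap.proj j)).comp ((innerSL ℝ).comp (ContinuousLinearMap.proj j)))

lemma absSqDeriv_apply (z v : Fin n → ℂ) : absSqDeriv n z v = ∑ j, 2 * inner ℝ (z j) (v j) := by
  simp only [absSqDeriv, sum_apply, smul_apply,
    ContinuousLinearMap.comp_apply, ContinuousLinearMap.flip_apply,
    ContinuousLinearMap.compL_apply, ContinuousLinearMap.proj_apply, smul_eq_mul,
    coe_innerSL_apply]

lemma hasFDerivAt_absSq (z : Fin n → ℂ) : HasFDerivAt absSq (absSqDeriv n z) z := by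
  have h : HasFDerivAt (fun z : Fin n → ℂ => ∑ j, ‖z j‖ ^ 2)
      (∑ j, 2 • (innerSL ℝ (z j)).comp (ContinuousLinearMap.proj (R := ℝ) j)) z :=
    HasFDerivAt.fun_sum fun j _ => (hasFDerivAt_apply j z).norm_sq
  refine h.congr_fderiv ?_
  ext v
  simp [absSqDeriv_apply, mul_add]

lemma contDiff_absSq : ContDiff ℝ ∞ (absSq (n := n)) :=
  ContDiff.sum fun j _ => (contDiff_coord j).norm_sq ℝ

/-- The power is absorbed by `exp ‖z‖`, and `‖z‖ - a‖z‖²` is bounded above by completing the square.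
-/
lemma exists_pow_mul_exp_neg_mul_absSq_le {a : ℝ} (ha : 0 < a) (k : ℕ) :
    ∃ C : ℝ, ∀ z : Fin n → ℂ, ‖z‖ ^ k * Real.exp (-a * absSq z) ≤ C := by
  refine ⟨Real.exp (1 / a) * ((k.factorial : ℝ)), fun z => ?_⟩
  have h1 : ‖z‖ ^ k / k.factorial ≤ Real.exp ‖z‖ :=
    Real.pow_div_factorial_le_exp _ (norm_nonneg _) k
  have h2 : ‖z‖ - a * ‖z‖ ^ 2 ≤ 1 / a := by
    have : 0 < 1 / a := by positivity
    have e : 1 / a - (‖z‖ - a * ‖z‖ ^ 2) = 3 / 4 * (1 / a) + (1 / a) * (a * ‖z‖ - 1 / 2) ^ 2 := by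
      field_simp; ring
    have : 0 ≤ (1 / a) * (a * ‖z‖ - 1 / 2) ^ 2 := by positivity
    linarith
  have h3 : Real.exp (-a * absSq z) ≤ Real.exp (-a * ‖z‖ ^ 2) := by
    have := norm_sq_le_absSq z
    exact Real.exp_le_exp.2 (by nlinarith)
  rw [div_le_iff₀ (by positivity)] at h1
  calc ‖z‖ ^ k * Real.exp (-a * absSq z)
      ≤ (Real.exp ‖z‖ * k.factorial) * Real.exp (-a * ‖z‖ ^ 2) := by gcongr
    _ = Real.exp (‖z‖ - a * ‖z‖ ^ 2) * k.factorial := by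
        rw [sub_eq_add_neg, Real.exp_add]; ring_nf
    _ ≤ _ := by gcongr

/-- The Gaussian `exp (-a |z|²)`, `a > 0`, as a Schwartz function. -/
def gaussian (n : ℕ) (a : ℝ) (ha : 0 < a) : 𝓢(Fin n → ℂ, ℂ) where
  toFun z := (Real.exp (-a * absSq z) : ℂ)
  smooth' := Complex.ofRealCLM.contDiff.comp
    (Real.contDiff_exp.comp (contDiff_const.mul contDiff_absSq))
  decay' k m := by
    have hsm : ContDiff ℝ ∞ fun z : Fin n → ℂ => (Real.exp (-a * absSq z) : ℂ) :=
      Complex.ofRealCLM.contDiff.comp (Real.contDiff_exp.comp (contDiff_const.mul contDiff_absSq))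
    let A : (Fin n → ℂ) →L[ℝ] (Fin n → ℂ) →L[ℝ] ℂ :=
      (-a) • (ContinuousLinearMap.compL ℝ (Fin n → ℂ) ℝ ℂ Complex.ofRealCLM).comp (absSqDeriv n)
    refine decay_of_fderiv_eq_smul A.hasTemperateGrowth hsm (fun z => ?_) (fun k => ?_) m k
    · have h1 : HasFDerivAt (fun z : Fin n → ℂ => (Real.exp (-a * absSq z) : ℂ)) _ z :=
        Complex.ofRealCLM.hasFDerivAt.comp z (((hasFDerivAt_absSq z).const_mul (-a)).exp)
      rw [h1.fderiv]
      ext v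
      simp [A]
    · obtain ⟨C, hC⟩ := exists_pow_mul_exp_neg_mul_absSq_le (n := n) ha k
      refine ⟨C, fun z => ?_⟩
      rw [Complex.norm_real, Real.norm_of_nonneg (Real.exp_pos _).le]
      exact hC z

lemma gaussian_apply {a : ℝ} (ha : 0 < a) (z : Fin n → ℂ) :
    gaussian n a ha z = (Real.exp (-a * absSq z) : ℂ) := rfl

lemma fderiv_gaussian {a : ℝ} (ha : 0 < a) (z v : Fin n → ℂ) :
    fderiv ℝ (gaussian n a ha) z v = -a * absSqDeriv n z v * gaussian n a ha z := by
  have h1 : HasFDerivAt (fun z : Fin n → ℂ => (Real.exp (-a * absSq z) : ℂ)) _ z :=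
    Complex.ofRealCLM.hasFDerivAt.comp z (((hasFDerivAt_absSq z).const_mul (-a)).exp)
  have h2 : fderiv ℝ (gaussian n a ha) z = _ := h1.fderiv
  rw [h2, gaussian_apply]
  simp
  ring

/-! ### Density of compactly supported functions in the Schwartz space. -/

section Cutoff

variable {E : Type*} [NormedAddCommGroup E] [NormedSpace ℝ E] [FiniteDimensional ℝ E]

/-- Every Schwartz function is the limit, in the Schwartz space, of a sequence of Schwartz functions
with compact support. -/
theorem exists_seq_hasCompactSupport_tendsto (f : 𝓢(E, ℂ)) :
    ∃ φ : ℕ → 𝓢(E, ℂ), (∀ k, HasCompactSupport (φ k)) ∧ Tendsto φ atTop (𝓝 f) := by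
  obtain ⟨χ, hχ1, hχc, hχs⟩ : ∃ χ : E → ℝ, (∀ x, ‖x‖ ≤ 1 → χ x = 1) ∧ HasCompactSupport χ ∧
      ContDiff ℝ ∞ χ := by
    let b : ContDiffBump (0 : E) := ⟨1, 2, one_pos, one_lt_two⟩
    exact ⟨b, fun x hx => b.one_of_mem_closedBall (by simpa using hx), b.hasCompactSupport,
      b.contDiff⟩
  let ρ : ℕ → ℝ := fun R => ((R : ℝ) + 1)⁻¹
  have hρ0 : ∀ R, 0 < ρ R := fun R => by positivity
  have hρ1 : ∀ R, ρ R ≤ 1 := fun R => inv_le_one_of_one_le₀ (by linarith [R.cast_nonneg (α := ℝ)])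
  let ψ : ℕ → E → ℝ := fun R x => χ (ρ R • x)
  have hψs : ∀ R, ContDiff ℝ ∞ (ψ R) := fun R => hχs.comp (contDiff_const_smul _)
  have hψc : ∀ R, HasCompactSupport (ψ R) := fun R => hχc.comp_smul (hρ0 R).ne'
  have hψt : ∀ R, (ψ R).HasTemperateGrowth := fun R => (hψc R).hasTemperateGrowth (hψs R)
  let η : ℕ → E → ℝ := fun R x => χ (ρ R • x) - 1
  have hηs : ∀ R, ContDiff ℝ ∞ (η R) := fun R => (hψs R).sub contDiff_const
  have hη : ∀ m : ℕ, ∃ C : ℝ, 0 ≤ C ∧ ∀ R x, ‖iteratedFDeriv ℝ m (η R) x‖ ≤ C * ρ R * ‖x‖ := by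
    intro m
    let χ' : E → ℝ := fun x => χ x - 1
    have hχ's : ContDiff ℝ ∞ χ' := hχs.sub contDiff_const
    obtain ⟨C, hC⟩ : ∃ C : ℝ, ∀ x, ‖iteratedFDeriv ℝ m χ' x‖ ≤ C := by
      have hcont : Continuous fun x => iteratedFDeriv ℝ m χ x :=
        hχs.continuous_iteratedFDeriv (mod_cast le_top)
      obtain ⟨C, hC⟩ := hcont.bounded_above_of_compact_support (hχc.iteratedFDeriv m)
      refine ⟨C + ‖iteratedFDeriv ℝ m (fun _ : E => (1 : ℝ)) 0‖, fun x => ?_⟩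
      have : iteratedFDeriv ℝ m χ' x =
          iteratedFDeriv ℝ m χ x - iteratedFDeriv ℝ m (fun _ : E => (1 : ℝ)) x :=
        iteratedFDeriv_sub_apply (hχs.contDiffAt.of_le (mod_cast le_top)) contDiffAt_const
      rw [this]
      refine (norm_sub_le _ _).trans (add_le_add (hC x) (le_of_eq ?_))
      rcases m with _ | m
      · simp [norm_iteratedFDeriv_zero]
      · rw [iteratedFDeriv_const_of_ne (by simp)]; simp
    have hC0 : 0 ≤ C := (norm_nonneg _).trans (hC 0)
    refine ⟨C, hC0, fun R x => ?_⟩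
    have e : iteratedFDeriv ℝ m (η R) x = ρ R ^ m • iteratedFDeriv ℝ m χ' (ρ R • x) :=
      congrFun (iteratedFDeriv_comp_const_smul (ρ R) (f := χ') (hχ's.of_le (mod_cast le_top))) x
    -- Near a point with `‖ρ R • x‖ < 1` the function `η R` vanishes identically. Elsewhere `1 ≤ ρ R
    -- * ‖x‖`, which turns the uniform bound on the derivatives into one with the small factor `ρ
    -- R`.
    rcases lt_or_ge (‖ρ R • x‖) 1 with hx | hx
    · have : χ' =ᶠ[𝓝 (ρ R • x)] fun _ => 0 := by
        have : Metric.ball (0 : E) 1 ∈ 𝓝 (ρ R • x) :=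
          Metric.isOpen_ball.mem_nhds (by simpa using hx)
        filter_upwards [this] with y hy
        simp [χ', hχ1 y (by simpa using (mem_ball_zero_iff.1 hy).le)]
      rw [e, (this.iteratedFDeriv ℝ m).eq_of_nhds]
      have hz : iteratedFDeriv ℝ m (fun _ : E => (0 : ℝ)) = 0 := by
        ext; simp [iteratedFDeriv_fun_zero]
      rw [hz]
      have := (hρ0 R).le
      simp only [Pi.zero_apply, smul_zero, norm_zero]
      positivity
    · rw [e, norm_smul]
      rw [norm_smul, Real.norm_of_nonneg (hρ0 R).le] at hx
      calc ‖ρ R ^ m‖ * ‖iteratedFDeriv ℝ m χ' (ρ R • x)‖ ≤ 1 * C := by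
            gcongr
            · rw [norm_pow, Real.norm_of_nonneg (hρ0 R).le]
              exact pow_le_one₀ (hρ0 R).le (hρ1 R)
            · exact hC _
        _ ≤ C * (ρ R * ‖x‖) := by rw [one_mul]; exact le_mul_of_one_le_right hC0 hx
        _ = _ := by ring
  choose D hD0 hD using hη
  have hev : ∀ R x, SchwartzMap.smulLeftCLM ℂ (ψ R) f x = ψ R x • f x := fun R x =>
    SchwartzMap.smulLeftCLM_apply_apply (hψt R) f x
  refine ⟨fun R => SchwartzMap.smulLeftCLM ℂ (ψ R) f, fun R => ?_, ?_⟩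
  · have : (SchwartzMap.smulLeftCLM ℂ (ψ R) f : E → ℂ) = fun x => ψ R x • f x := funext (hev R)
    rw [this]
    exact (hψc R).smul_right
  · rw [(schwartz_withSeminorms ℝ E ℂ).tendsto_nhds_atTop]
    rintro ⟨k, m⟩ ε hε
    -- The Leibniz rule; the factor `‖x‖` lost in `hD` is paid for by the seminorm of order `k + 1`.
    let K : ℝ := ∑ i ∈ Finset.range (m + 1), (m.choose i : ℝ) * D i *
      SchwartzMap.seminorm ℝ (k + 1) (m - i) f
    have hK : 0 ≤ K := Finset.sum_nonneg fun i _ =>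
      mul_nonneg (mul_nonneg (by positivity) (hD0 i)) (apply_nonneg _ _)
    have hbd : ∀ R, SchwartzMap.seminorm ℝ k m (SchwartzMap.smulLeftCLM ℂ (ψ R) f - f)
        ≤ K * ρ R := by
      intro R
      refine SchwartzMap.seminorm_le_bound ℝ k m _ (mul_nonneg hK (hρ0 R).le) fun x => ?_
      have e : ((SchwartzMap.smulLeftCLM ℂ (ψ R) f - f : 𝓢(E, ℂ)) : E → ℂ) =
          fun x => η R x • f x := by
        ext y
        rw [sub_apply, hev]
        simp only [ψ, η, sub_smul, one_smul]
      rw [e]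
      have h1 := norm_iteratedFDeriv_smul_le (𝕜 := ℝ) (hηs R) (f.smooth ⊤) x
        (n := m) (mod_cast le_top)
      calc _ ≤ ‖x‖ ^ k * ∑ i ∈ Finset.range (m + 1), (m.choose i : ℝ) *
            ‖iteratedFDeriv ℝ i (η R) x‖ * ‖iteratedFDeriv ℝ (m - i) f x‖ := by gcongr
        _ ≤ _ := by
            rw [Finset.mul_sum, Finset.sum_mul]
            refine Finset.sum_le_sum fun i _ => ?_
            have h2 := SchwartzMap.le_seminorm ℝ (k + 1) (m - i) f x
            have := hD0 i
            have := (hρ0 R).le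
            calc _ ≤ ‖x‖ ^ k * ((m.choose i : ℝ) * (D i * ρ R * ‖x‖) *
                  ‖iteratedFDeriv ℝ (m - i) f x‖) := by gcongr; exact hD i R x
              _ = (m.choose i : ℝ) * D i * (‖x‖ ^ (k + 1) * ‖iteratedFDeriv ℝ (m - i) f x‖) *
                  ρ R := by ring
              _ ≤ _ := by gcongr
    have hlim : Tendsto (fun R => K * ρ R) atTop (𝓝 0) := by
      have := (tendsto_one_div_add_atTop_nhds_zero_nat (𝕜 := ℝ)).const_mul K
      simpa [ρ, one_div] using this
    obtain ⟨R₀, hR₀⟩ := eventually_atTop.1 (hlim.eventually (gt_mem_nhds hε))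
    exact ⟨R₀, fun R hR => (hbd R).trans_lt (hR₀ R hR)⟩

end Cutoff

/-! ### First-order operators, their commutators and adjoints. -/

/-- The first-order differential operator `∂_v + i ∂_w + ℓ` on the Schwartz space, where `ℓ` is a
real-linear form. -/
def firstOrder (v w : Fin n → ℂ) (l : (Fin n → ℂ) →L[ℝ] ℂ) :
    𝓢(Fin n → ℂ, ℂ) →L[ℂ] 𝓢(Fin n → ℂ, ℂ) :=
  LineDeriv.lineDerivOpCLM ℂ 𝓢(Fin n → ℂ, ℂ) v +
    Complex.I • LineDeriv.lineDerivOpCLM ℂ 𝓢(Fin n → ℂ, ℂ) w + SchwartzMap.smulLeftCLM ℂ l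

lemma firstOrder_apply (v w : Fin n → ℂ) (l : (Fin n → ℂ) →L[ℝ] ℂ) (f : 𝓢(Fin n → ℂ, ℂ))
    (z : Fin n → ℂ) : firstOrder v w l f z =
      fderiv ℝ f z v + Complex.I * fderiv ℝ f z w + l z * f z := by
  simp only [firstOrder, add_apply, smul_apply, LineDeriv.lineDerivOpCLM_apply,
    SchwartzMap.lineDerivOp_apply_eq_fderiv, smul_eq_mul,
    SchwartzMap.smulLeftCLM_apply_apply l.hasTemperateGrowth]

lemma fderiv_firstOrder (v w : Fin n → ℂ) (l : (Fin n → ℂ) →L[ℝ] ℂ) (f : 𝓢(Fin n → ℂ, ℂ))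
    (z x : Fin n → ℂ) : fderiv ℝ (firstOrder v w l f) z x =
      fderiv ℝ (fderiv ℝ f) z x v + Complex.I * fderiv ℝ (fderiv ℝ f) z x w + l z * fderiv ℝ f z x
        + l x * f z := by
  have hf : ContDiff ℝ ∞ (fderiv ℝ f) := (f.smooth ⊤).fderiv_right (by simp)
  have h2 : HasFDerivAt (fderiv ℝ f) (fderiv ℝ (fderiv ℝ f) z) z :=
    (hf.differentiable (by simp) z).hasFDerivAt
  have e : (firstOrder v w l f : (Fin n → ℂ) → ℂ) =
      fun z => fderiv ℝ f z v + Complex.I * fderiv ℝ f z w + l z * f z :=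
    funext (firstOrder_apply v w l f)
  have hv : HasFDerivAt (fun z => fderiv ℝ f z v) _ z := h2.clm_apply (hasFDerivAt_const v z)
  have hw : HasFDerivAt (fun z => fderiv ℝ f z w) _ z := h2.clm_apply (hasFDerivAt_const w z)
  have h := (hv.add (hw.const_mul Complex.I)).add (l.hasFDerivAt.mul (f.hasFDerivAt z))
  rw [e]
  refine (congrArg (fun T => T x) h.fderiv).trans ?_
  simp
  ring

/-- The commutator of two first-order operators is multiplication by a constant. -/
theorem firstOrder_comm (v w v' w' : Fin n → ℂ) (l l' : (Fin n → ℂ) →L[ℝ] ℂ)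
    (f : 𝓢(Fin n → ℂ, ℂ)) : firstOrder v w l (firstOrder v' w' l' f) =
      firstOrder v' w' l' (firstOrder v w l f) +
        (l' v + Complex.I * l' w - l v' - Complex.I * l w') • f := by
  ext z
  -- Symmetry of the second derivative cancels the second-order terms; the first-order ones cancel
  -- by themselves, and only derivatives of the linear forms remain.
  have hs : IsSymmSndFDerivAt ℝ f z := by
    refine ((f.smooth 2).contDiffAt (x := z)).isSymmSndFDerivAt ?_
    rw [minSmoothness_of_isRCLikeNormedField]
    rfl
  rw [add_apply, smul_apply, firstOrder_apply v w l (firstOrder v' w' l' f),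
    firstOrder_apply v' w' l' (firstOrder v w l f), smul_eq_mul]
  simp only [fderiv_firstOrder]
  rw [firstOrder_apply v' w', firstOrder_apply v w, hs.eq v' v, hs.eq v' w, hs.eq w' v, hs.eq w' w]
  ring

variable (n) in
/-- The inclusion of the Schwartz space into `L²`. -/
abbrev toL2 : 𝓢(Fin n → ℂ, ℂ) →L[ℂ] L2 n := SchwartzMap.toLpCLM ℂ ℂ 2 volume

lemma coeFn_toL2 (f : 𝓢(Fin n → ℂ, ℂ)) : toL2 n f =ᵐ[volume] f := f.coeFn_toLp 2 volume

lemma inner_toL2_left (f : 𝓢(Fin n → ℂ, ℂ)) (u : L2 n) :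
    inner ℂ (toL2 n f) u = ∫ z, conj (f z) * u z := by
  rw [L2.inner_def]
  refine integral_congr_ae ?_
  filter_upwards [coeFn_toL2 f] with z hz
  rw [hz, RCLike.inner_apply, mul_comm]

lemma inner_toL2 (f g : 𝓢(Fin n → ℂ, ℂ)) :
    inner ℂ (toL2 n f) (toL2 n g) = ∫ z, conj (f z) * g z := by
  rw [inner_toL2_left]
  refine integral_congr_ae ?_
  filter_upwards [coeFn_toL2 g] with z hz
  rw [hz]

/-- The complex conjugate of a real-linear form. -/
def conjForm (l : (Fin n → ℂ) →L[ℝ] ℂ) : (Fin n → ℂ) →L[ℝ] ℂ :=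
  Complex.conjCLE.toContinuousLinearMap.comp l

@[simp] lemma conjForm_apply (l : (Fin n → ℂ) →L[ℝ] ℂ) (z : Fin n → ℂ) :
    conjForm l z = conj (l z) := rfl

/-- Integration by parts: the formal adjoint of a first-order operator. -/
theorem inner_firstOrder (v w : Fin n → ℂ) (l : (Fin n → ℂ) →L[ℝ] ℂ)
    (f g : 𝓢(Fin n → ℂ, ℂ)) : inner ℂ (toL2 n (firstOrder (-v) w (conjForm l) f)) (toL2 n g) =
      inner ℂ (toL2 n f) (toL2 n (firstOrder v w l g)) := by
  let B : ℂ →L[ℝ] ℂ →L[ℝ] ℂ :=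
    (ContinuousLinearMap.mul ℝ ℂ).comp Complex.conjCLE.toContinuousLinearMap
  have key : ∀ x : Fin n → ℂ, ∫ z, conj (f z) * fderiv ℝ g z x =
      -∫ z, conj (fderiv ℝ f z x) * g z := fun x =>
    SchwartzMap.integral_bilinear_lineDerivOp_right_eq_neg_left f g B x
  have hint : ∀ p q : 𝓢(Fin n → ℂ, ℂ), Integrable fun z => conj (p z) * q z := fun p q =>
    (SchwartzMap.pairing B p q).integrable
  have hint1 : ∀ x, Integrable fun z => conj (f z) * fderiv ℝ g z x := fun x =>
    hint f (LineDeriv.lineDerivOpCLM ℂ 𝓢(Fin n → ℂ, ℂ) x g)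
  have hint2 : ∀ x, Integrable fun z => conj (fderiv ℝ f z x) * g z := fun x =>
    hint (LineDeriv.lineDerivOpCLM ℂ 𝓢(Fin n → ℂ, ℂ) x f) g
  have hint3 : Integrable fun z => conj (f z) * (l z * g z) := by
    have := hint f (SchwartzMap.smulLeftCLM ℂ l g)
    simpa only [SchwartzMap.smulLeftCLM_apply_apply l.hasTemperateGrowth, smul_eq_mul] using this
  rw [inner_toL2, inner_toL2]
  have e1 : ∀ z, conj (firstOrder (-v) w (conjForm l) f z) * g z =
      -1 * (conj (fderiv ℝ f z v) * g z) + -Complex.I * (conj (fderiv ℝ f z w) * g z) +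
        conj (f z) * (l z * g z) := by
    intro z
    rw [firstOrder_apply]
    simp only [map_neg, map_add, map_mul, Complex.conj_I, conjForm_apply, Complex.conj_conj]
    ring
  have e2 : ∀ z, conj (f z) * firstOrder v w l g z =
      conj (f z) * fderiv ℝ g z v + Complex.I * (conj (f z) * fderiv ℝ g z w) +
        conj (f z) * (l z * g z) := by
    intro z
    rw [firstOrder_apply]
    ring
  simp_rw [e1, e2]
  rw [integral_add (((hint2 v).const_mul _).fun_add ((hint2 w).const_mul _)) hint3,
    integral_add ((hint1 v).fun_add ((hint1 w).const_mul _)) hint3,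
    integral_add ((hint2 v).const_mul _) ((hint2 w).const_mul _),
    integral_add (hint1 v) ((hint1 w).const_mul _), integral_const_mul, integral_const_mul,
    integral_const_mul, key, key]
  ring

/-! ### Creation and annihilation operators. -/

/-- The modes: two for each coordinate, of which the first enters the twisted Laplacian. -/
abbrev Mode (n : ℕ) : Type := Fin n ⊕ Fin n

/-- The coordinate `z_j` as a real-linear form. -/
def coordForm (j : Fin n) : (Fin n → ℂ) →L[ℝ] ℂ := ContinuousLinearMap.proj j

@[simp] lemma coordForm_apply (j : Fin n) (z : Fin n → ℂ) : coordForm j z = z j := rfl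

/-- The real direction of the derivative in an annihilation operator. -/
def modeRe : Mode n → (Fin n → ℂ) := Sum.elim (fun j => Pi.single j (1 / 2))
  (fun j => Pi.single j (1 / 2))

/-- The direction whose derivative enters an annihilation operator with the factor `i`. -/
def modeIm : Mode n → (Fin n → ℂ) := Sum.elim (fun j => Pi.single j (-(Complex.I / 2)))
  (fun j => Pi.single j (Complex.I / 2))

/-- The zeroth-order term of an annihilation operator. -/
def modeForm : Mode n → (Fin n → ℂ) →L[ℝ] ℂ :=
  Sum.elim (fun j => (1 / 2 : ℝ) • conjForm (coordForm j)) (fun j => (1 / 2 : ℝ) • coordForm j)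

/-- The annihilation operators: `∂_{z_j} + z̄_j / 2` and `∂_{z̄_j} + z_j / 2`. -/
def ann (i : Mode n) : 𝓢(Fin n → ℂ, ℂ) →L[ℂ] 𝓢(Fin n → ℂ, ℂ) :=
  firstOrder (modeRe i) (modeIm i) (modeForm i)

/-- The creation operators: `-∂_{z̄_j} + z_j / 2` and `-∂_{z_j} + z̄_j / 2`. -/
def cre (i : Mode n) : 𝓢(Fin n → ℂ, ℂ) →L[ℂ] 𝓢(Fin n → ℂ, ℂ) :=
  firstOrder (-modeRe i) (modeIm i) (conjForm (modeForm i))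

theorem inner_cre (i : Mode n) (f g : 𝓢(Fin n → ℂ, ℂ)) :
    inner ℂ (toL2 n (cre i f)) (toL2 n g) = inner ℂ (toL2 n f) (toL2 n (ann i g)) :=
  inner_firstOrder _ _ _ f g

theorem inner_ann (i : Mode n) (f g : 𝓢(Fin n → ℂ, ℂ)) :
    inner ℂ (toL2 n (ann i f)) (toL2 n g) = inner ℂ (toL2 n f) (toL2 n (cre i g)) := by
  rw [← inner_conj_symm, ← inner_cre, inner_conj_symm]

lemma smul_single_half (j : Fin n) (c : ℂ) : (Pi.single j (c / 2) : Fin n → ℂ) =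
    (1 / 2 : ℝ) • Pi.single j c := by
  rw [← Pi.single_smul]
  congr 1
  simp
  ring

/-- The canonical commutation relations. The constant from `firstOrder_comm` is evaluated case by
case; for `i = k` the real and the imaginary direction contribute `1 / 2` each. -/
theorem ann_cre (i k : Mode n) (f : 𝓢(Fin n → ℂ, ℂ)) :
    ann i (cre k f) = cre k (ann i f) + (if i = k then 1 else 0 : ℂ) • f := by
  rw [ann, cre, firstOrder_comm]
  congr 2
  rcases i with j | j <;> rcases k with j' | j' <;>
    simp only [modeRe, modeIm, modeForm, Sum.elim_inl, Sum.elim_inr, conjForm_apply, smul_apply,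
      coordForm_apply, Pi.single_apply, Pi.neg_apply, Sum.inl.injEq, Sum.inr.injEq, reduceCtorEq,
      if_false] <;>
    by_cases h : j = j' <;> simp [h, eq_comm, map_ofNat] <;> ring_nf <;> simp <;> ring

theorem cre_comm (i k : Mode n) (f : 𝓢(Fin n → ℂ, ℂ)) : cre i (cre k f) = cre k (cre i f) := by
  rw [cre, cre, firstOrder_comm]
  convert add_zero _
  rw [smul_eq_zero]
  left
  rcases i with j | j <;> rcases k with j' | j' <;>
    simp only [modeRe, modeIm, modeForm, Sum.elim_inl, Sum.elim_inr, conjForm_apply, smul_apply,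
      coordForm_apply, Pi.single_apply, Pi.neg_apply] <;>
    by_cases h : j = j' <;> simp [h, eq_comm, map_ofNat] <;> ring_nf

lemma ann_inl_apply (j : Fin n) (f : 𝓢(Fin n → ℂ, ℂ)) :
    (ann (Sum.inl j) f : (Fin n → ℂ) → ℂ) = Z j f := by
  ext z
  simp only [ann, firstOrder_apply, modeRe, modeIm, modeForm, Sum.elim_inl, Z, dz, ← neg_div,
    smul_single_half, map_smul, Pi.single_neg, map_neg]
  simp
  ring

lemma cre_inl_apply (j : Fin n) (f : 𝓢(Fin n → ℂ, ℂ)) :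
    (cre (Sum.inl j) f : (Fin n → ℂ) → ℂ) = Zbar j f := by
  ext z
  simp only [cre, firstOrder_apply, modeRe, modeIm, modeForm, Sum.elim_inl, Zbar, dzbar, ← neg_div,
    smul_single_half, map_smul, Pi.single_neg, map_neg]
  simp [map_ofNat]
  ring

/-- The sum of a creation and an annihilation operator is the multiplication by `z_j`. -/
lemma cre_inl_add_ann_inr (j : Fin n) (f : 𝓢(Fin n → ℂ, ℂ)) (z : Fin n → ℂ) :
    cre (Sum.inl j) f z + ann (Sum.inr j) f z = z j * f z := by
  simp only [cre, ann, firstOrder_apply, modeRe, modeIm, modeForm, Sum.elim_inl, Sum.elim_inr,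
    Pi.single_neg, map_neg]
  simp [map_ofNat]
  ring

/-- The sum of a creation and an annihilation operator is the multiplication by `z̄_j`. -/
lemma cre_inr_add_ann_inl (j : Fin n) (f : 𝓢(Fin n → ℂ, ℂ)) (z : Fin n → ℂ) :
    cre (Sum.inr j) f z + ann (Sum.inl j) f z = conj (z j) * f z := by
  simp only [cre, ann, firstOrder_apply, modeRe, modeIm, modeForm, Sum.elim_inl, Sum.elim_inr,
    Pi.single_neg, map_neg]
  simp [map_ofNat]
  ring

/-- The twisted Laplacian on the Schwartz space. -/
def laplaceS (n : ℕ) : 𝓢(Fin n → ℂ, ℂ) →L[ℂ] 𝓢(Fin n → ℂ, ℂ) :=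
  ∑ j : Fin n, (ann (Sum.inl j) ∘L cre (Sum.inl j) + cre (Sum.inl j) ∘L ann (Sum.inl j))

lemma laplaceS_apply (f : 𝓢(Fin n → ℂ, ℂ)) : laplaceS n f =
    ∑ j : Fin n, (ann (Sum.inl j) (cre (Sum.inl j) f) + cre (Sum.inl j) (ann (Sum.inl j) f)) := by
  simp [laplaceS, sum_apply]

lemma coe_laplaceS (f : 𝓢(Fin n → ℂ, ℂ)) :
    (laplaceS n f : (Fin n → ℂ) → ℂ) = twistedLaplacian f := by
  ext z
  simp only [laplaceS_apply, sum_apply, add_apply, ann_inl_apply, cre_inl_apply, twistedLaplacian]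

theorem inner_laplaceS (f g : 𝓢(Fin n → ℂ, ℂ)) :
    inner ℂ (toL2 n (laplaceS n f)) (toL2 n g) = inner ℂ (toL2 n f) (toL2 n (laplaceS n g)) := by
  simp only [laplaceS_apply, map_sum, map_add, sum_inner, inner_sum, inner_add_left,
    inner_add_right, inner_cre, inner_ann]

/-- The quadratic form of the twisted Laplacian. -/
theorem inner_laplaceS_self (f : 𝓢(Fin n → ℂ, ℂ)) :
    inner ℂ (toL2 n f) (toL2 n (laplaceS n f)) =
      ((∑ j : Fin n, (‖toL2 n (ann (Sum.inl j) f)‖ ^ 2 + ‖toL2 n (cre (Sum.inl j) f)‖ ^ 2) : ℝ)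
        : ℂ) := by
  simp only [laplaceS_apply, map_sum, map_add, inner_sum, inner_add_right, ← inner_cre,
    ← inner_ann, inner_self_eq_norm_sq_to_K, Complex.ofReal_sum, Complex.ofReal_add,
    Complex.ofReal_pow]
  refine Finset.sum_congr rfl fun j _ => ?_
  simp only [Complex.coe_algebraMap]
  rw [add_comm]

/-! ### The ground state and the ladder of excited states. -/

lemma half_pos' : (0 : ℝ) < 1 / 2 := by norm_num

/-- The ground state `exp (-|z|²/2)`. -/
def ground (n : ℕ) : 𝓢(Fin n → ℂ, ℂ) := gaussian n (1 / 2) half_pos'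

lemma ann_gaussian_inl {a : ℝ} (ha : 0 < a) (j : Fin n) (z : Fin n → ℂ) :
    ann (Sum.inl j) (gaussian n a ha) z = (1 / 2 - a) * conj (z j) * gaussian n a ha z := by
  have h1 : absSqDeriv n z (Pi.single j (1 / 2)) = (z j).re := by
    rw [absSqDeriv_apply, Finset.sum_eq_single j (fun k _ hk => by simp [hk]) (by simp)]
    simp
  have h2 : absSqDeriv n z (Pi.single j (Complex.I / 2)) = (z j).im := by
    rw [absSqDeriv_apply, Finset.sum_eq_single j (fun k _ hk => by simp [hk]) (by simp)]
    simp
  simp only [ann, firstOrder_apply, modeRe, modeIm, modeForm, Sum.elim_inl, fderiv_gaussian, h1,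
    Pi.single_neg, map_neg, h2]
  have : conj (z j) = (z j).re - (z j).im * Complex.I := by
    apply Complex.ext <;> simp
  simp [this]
  ring

lemma ann_gaussian_inr {a : ℝ} (ha : 0 < a) (j : Fin n) (z : Fin n → ℂ) :
    ann (Sum.inr j) (gaussian n a ha) z = (1 / 2 - a) * z j * gaussian n a ha z := by
  have h1 : absSqDeriv n z (Pi.single j (1 / 2)) = (z j).re := by
    rw [absSqDeriv_apply, Finset.sum_eq_single j (fun k _ hk => by simp [hk]) (by simp)]
    simp
  have h2 : absSqDeriv n z (Pi.single j (Complex.I / 2)) = (z j).im := by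
    rw [absSqDeriv_apply, Finset.sum_eq_single j (fun k _ hk => by simp [hk]) (by simp)]
    simp
  simp only [ann, firstOrder_apply, modeRe, modeIm, modeForm, Sum.elim_inr, fderiv_gaussian, h1,
    h2]
  have : z j = (z j).re + (z j).im * Complex.I := (Complex.re_add_im _).symm
  rw [smul_apply, coordForm_apply]
  simp
  linear_combination (a * gaussian n a ha z) * this

lemma ann_ground (i : Mode n) : ann i (ground n) = 0 := by
  ext z
  rcases i with j | j
  · rw [ground, ann_gaussian_inl]; simp
  · rw [ground, ann_gaussian_inr]; simp

lemma cre_gaussian_inl {a : ℝ} (ha : 0 < a) (j : Fin n) (z : Fin n → ℂ) :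
    cre (Sum.inl j) (gaussian n a ha) z = (1 / 2 + a) * z j * gaussian n a ha z := by
  have := cre_inl_add_ann_inr j (gaussian n a ha) z
  rw [ann_gaussian_inr] at this
  linear_combination this

/-- Creation operators may be applied in any order, so that states are indexed by multisets. -/
instance : LeftCommutative (fun (i : Mode n) (f : 𝓢(Fin n → ℂ, ℂ)) => cre i f) :=
  ⟨fun i k f => cre_comm i k f⟩

/-- The state obtained from the ground state by applying the creation operators of a multiset of
modes. -/
def excited (s : Multiset (Mode n)) : 𝓢(Fin n → ℂ, ℂ) :=
  s.foldr (fun i f => cre i f) (ground n)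

@[simp] lemma excited_zero : excited (0 : Multiset (Mode n)) = ground n := rfl

lemma excited_cons (i : Mode n) (s : Multiset (Mode n)) :
    excited (i ::ₘ s) = cre i (excited s) := Multiset.foldr_cons _ _ _ _

/-- The annihilation operator acts as a derivation on words in creation operators and kills the
ground state. If `i` does not occur in `s`, the coefficient is zero and the junk value of `s.erase
i` is irrelevant. -/
theorem ann_excited (i : Mode n) (s : Multiset (Mode n)) :
    ann i (excited s) = (s.count i : ℂ) • excited (s.erase i) := by
  induction s using Multiset.induction_on with
  | empty => simp [ann_ground]
  | cons k s ih =>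
    rw [excited_cons, ann_cre, ih, map_smul, ← excited_cons]
    by_cases h : i = k
    · subst h
      rw [Multiset.count_cons_self, Multiset.erase_cons_head, if_pos rfl, one_smul]
      by_cases hi : i ∈ s
      · rw [Multiset.cons_erase hi]
        push_cast
        module
      · rw [Multiset.count_eq_zero_of_notMem hi]
        simp
    · rw [Multiset.count_cons_of_ne h, Multiset.erase_cons_tail _ (Ne.symm h), if_neg h, zero_smul,
        add_zero]

theorem cre_ann_excited (i : Mode n) (s : Multiset (Mode n)) :
    cre i (ann i (excited s)) = (s.count i : ℂ) • excited s := by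
  rw [ann_excited, map_smul, ← excited_cons]
  by_cases hi : i ∈ s
  · rw [Multiset.cons_erase hi]
  · rw [Multiset.count_eq_zero_of_notMem hi]
    simp

theorem ann_cre_excited (i : Mode n) (s : Multiset (Mode n)) :
    ann i (cre i (excited s)) = (s.count i + 1 : ℂ) • excited s := by
  rw [ann_cre, cre_ann_excited, if_pos rfl]
  module

/-- The eigenvalue of the state `excited s`. -/
def energy (s : Multiset (Mode n)) : ℝ := n + 2 * ∑ j : Fin n, (s.count (Sum.inl j) : ℝ)

theorem laplaceS_excited (s : Multiset (Mode n)) :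
    laplaceS n (excited s) = (energy s : ℂ) • excited s := by
  rw [laplaceS_apply]
  simp only [cre_ann_excited, ann_cre_excited, ← add_smul]
  rw [← Finset.sum_smul]
  congr 1
  simp only [energy, Finset.sum_add_distrib]
  push_cast
  simp
  ring

lemma toL2_injective : Function.Injective (toL2 n) := SchwartzMap.injective_toLp 2 volume

/-- By adjointness `‖cre i f‖² = (s.count i + 1) ‖f‖²` for `f = excited s`, so no creation step
annihilates a state. -/
lemma toL2_excited_ne_zero (s : Multiset (Mode n)) : toL2 n (excited s) ≠ 0 := by
  induction s using Multiset.induction_on with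
  | empty =>
    rw [Ne, map_eq_zero_iff _ toL2_injective]
    intro h
    have := congrArg (fun f : 𝓢(Fin n → ℂ, ℂ) => f 0) h
    rw [excited_zero, ground] at this
    simp only [gaussian_apply, zero_apply, Complex.ofReal_eq_zero] at this
    exact (Real.exp_pos _).ne' this
  | cons i s ih =>
    intro h
    have h1 := inner_cre i (excited s) (excited (i ::ₘ s))
    rw [h, inner_zero_right, excited_cons, ann_cre_excited, map_smul, inner_smul_right] at h1
    rcases mul_eq_zero.1 h1.symm with h2 | h2
    · exact Nat.cast_add_one_ne_zero (R := ℂ) _ h2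
    · exact ih (inner_self_eq_zero.1 h2)

/-- Distinct multisets may have equal energy, so `ℒ` alone does not separate them. The symmetric
number operator `cre i ∘ ann i` of a mode with different counts does. -/
theorem inner_excited_of_ne {s t : Multiset (Mode n)} (h : s ≠ t) :
    inner ℂ (toL2 n (excited s)) (toL2 n (excited t)) = 0 := by
  obtain ⟨i, hi⟩ : ∃ i, s.count i ≠ t.count i := by
    by_contra! hc
    exact h (Multiset.ext.2 hc)
  have h1 : inner ℂ (toL2 n (cre i (ann i (excited s)))) (toL2 n (excited t)) =
      inner ℂ (toL2 n (excited s)) (toL2 n (cre i (ann i (excited t)))) := by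
    rw [inner_cre, inner_ann]
  rw [cre_ann_excited, cre_ann_excited, map_smul, map_smul, inner_smul_left, inner_smul_right,
    Complex.conj_natCast, ← sub_eq_zero, ← sub_mul] at h1
  exact (mul_eq_zero.1 h1).resolve_left (sub_ne_zero.2 (Nat.cast_injective.ne hi))

/-! ### Completeness of the excited states. -/

/-- The span of the excited states. -/
def excitedSpan (n : ℕ) : Submodule ℂ 𝓢(Fin n → ℂ, ℂ) := Submodule.span ℂ (Set.range excited)

lemma cre_mem_excitedSpan (i : Mode n) {f : 𝓢(Fin n → ℂ, ℂ)} (hf : f ∈ excitedSpan n) :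
    cre i f ∈ excitedSpan n := by
  induction hf using Submodule.span_induction with
  | mem f hf =>
    obtain ⟨s, rfl⟩ := hf
    exact Submodule.subset_span ⟨i ::ₘ s, excited_cons i s⟩
  | zero => simp
  | add f g _ _ hf hg => rw [map_add]; exact add_mem hf hg
  | smul c f _ hf => rw [map_smul]; exact Submodule.smul_mem _ _ hf

lemma ann_mem_excitedSpan (i : Mode n) {f : 𝓢(Fin n → ℂ, ℂ)} (hf : f ∈ excitedSpan n) :
    ann i f ∈ excitedSpan n := by
  induction hf using Submodule.span_induction with
  | mem f hf =>
    obtain ⟨s, rfl⟩ := hf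
    rw [ann_excited]
    exact Submodule.smul_mem _ _ (Submodule.subset_span ⟨_, rfl⟩)
  | zero => simp
  | add f g _ _ hf hg => rw [map_add]; exact add_mem hf hg
  | smul c f _ hf => rw [map_smul]; exact Submodule.smul_mem _ _ hf

lemma real_form_apply (l : (Fin n → ℂ) →L[ℝ] ℝ) (z : Fin n → ℂ) :
    l z = ∑ j, ((z j).re * l (Pi.single j 1) + (z j).im * l (Pi.single j Complex.I)) := by
  have hz : z = ∑ j, ((z j).re • (Pi.single j 1 : Fin n → ℂ) +
      (z j).im • (Pi.single j Complex.I : Fin n → ℂ)) := by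
    ext k
    rw [Finset.sum_apply, Finset.sum_eq_single k (fun j _ hj => by simp [hj.symm]) (by simp)]
    simp
  conv_lhs => rw [hz]
  simp

/-- Multiplication by `z_j` and by `z̄_j` is a sum of a creation and an annihilation operator, both
of which preserve the span; `l` is a combination of these coordinates. -/
lemma exists_mem_excitedSpan_mul (l : (Fin n → ℂ) →L[ℝ] ℝ) {f : 𝓢(Fin n → ℂ, ℂ)}
    (hf : f ∈ excitedSpan n) : ∃ g ∈ excitedSpan n, ∀ z, g z = l z * f z := by
  refine ⟨∑ j, ((l (Pi.single j 1) / 2 : ℂ) • (cre (Sum.inl j) f + ann (Sum.inr j) f +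
    (cre (Sum.inr j) f + ann (Sum.inl j) f)) + (-Complex.I * l (Pi.single j Complex.I) / 2 : ℂ) •
    (cre (Sum.inl j) f + ann (Sum.inr j) f - (cre (Sum.inr j) f + ann (Sum.inl j) f))),
    Submodule.sum_mem _ fun j _ => ?_, fun z => ?_⟩
  · have h1 := fun i => cre_mem_excitedSpan i hf
    have h2 := fun i => ann_mem_excitedSpan i hf
    exact add_mem (Submodule.smul_mem _ _ (add_mem (add_mem (h1 _) (h2 _)) (add_mem (h1 _) (h2 _))))
      (Submodule.smul_mem _ _ (sub_mem (add_mem (h1 _) (h2 _)) (add_mem (h1 _) (h2 _))))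
  · rw [real_form_apply l z, sum_apply, Complex.ofReal_sum, Finset.sum_mul]
    refine Finset.sum_congr rfl fun j _ => ?_
    simp only [add_apply, smul_apply, sub_apply, cre_inl_add_ann_inr, cre_inr_add_ann_inl]
    have h1 : conj (z j) = (z j).re - (z j).im * Complex.I := by apply Complex.ext <;> simp
    have h2 : z j = (z j).re + (z j).im * Complex.I := (Complex.re_add_im _).symm
    rw [h1]
    generalize (z j).re = x at *
    generalize (z j).im = y at *
    rw [h2]
    push_cast
    simp only [smul_eq_mul]
    linear_combination (-(y * l (Pi.single j Complex.I) * f z) : ℂ) * Complex.I_sq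

lemma exists_mem_excitedSpan_pow (l : (Fin n → ℂ) →L[ℝ] ℝ) (k : ℕ) :
    ∃ g ∈ excitedSpan n, ∀ z, g z = (l z : ℂ) ^ k * ground n z := by
  induction k with
  | zero => exact ⟨ground n, Submodule.subset_span ⟨0, rfl⟩, by simp⟩
  | succ k ih =>
    obtain ⟨g, hg, hgz⟩ := ih
    obtain ⟨g', hg', hgz'⟩ := exists_mem_excitedSpan_mul l hg
    exact ⟨g', hg', fun z => by rw [hgz', hgz]; ring⟩

section CharFun

variable {E : Type*} [NormedAddCommGroup E] [NormedSpace ℝ E] [CompleteSpace E]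
  [MeasurableSpace E] [BorelSpace E] [SecondCountableTopology E] {μ : Measure E}

/-- A real integrable function whose Fourier transform vanishes is zero almost everywhere. -/
theorem ae_eq_zero_of_integral_exp_mul_ofReal {r : E → ℝ} (hr : Integrable r μ)
    (h : ∀ l : E →L[ℝ] ℝ, ∫ x, Complex.exp (l x * Complex.I) * r x ∂μ = 0) : r =ᵐ[μ] 0 := by
  have hfin : ∀ {q : E → ℝ}, Integrable q μ →
      IsFiniteMeasure (μ.withDensity fun x => ENNReal.ofReal (q x)) := fun hq =>
    isFiniteMeasure_withDensity_ofReal hq.hasFiniteIntegral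
  have hchar : ∀ {q : E → ℝ}, Integrable q μ → ∀ l : E →L[ℝ] ℝ,
      charFunDual (μ.withDensity fun x => ENNReal.ofReal (q x)) l =
        ∫ x, Complex.exp (l x * Complex.I) * (max (q x) 0 : ℝ) ∂μ := by
    intro q hq l
    rw [charFunDual_apply, integral_withDensity_eq_integral_toReal_smul₀
      hq.aestronglyMeasurable.aemeasurable.ennreal_ofReal
      (ae_of_all _ fun x => ENNReal.ofReal_lt_top)]
    refine integral_congr_ae (ae_of_all _ fun x => ?_)
    simp only [ENNReal.toReal_ofReal', Complex.real_smul]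
    ring
  have hint : ∀ {q : E → ℝ}, Integrable q μ → ∀ l : E →L[ℝ] ℝ,
      Integrable (fun x => Complex.exp (l x * Complex.I) * (q x : ℂ)) μ := by
    intro q hq l
    refine hq.ofReal.bdd_mul (c := 1) (by fun_prop) (ae_of_all _ fun x => ?_)
    rw [Complex.norm_exp_ofReal_mul_I]
  have hr' := hr.neg
  have := hfin hr
  have := hfin hr'
  -- The densities are the positive and negative parts of `r`. The measures have equal
  -- characteristic functions, so the two parts agree; as one of them vanishes at each point, `r =
  -- 0`.
  have heq : (μ.withDensity fun x => ENNReal.ofReal (r x)) =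
      μ.withDensity fun x => ENNReal.ofReal ((-r) x) := by
    refine Measure.ext_of_charFunDual ?_
    ext l
    rw [hchar hr, hchar hr', ← sub_eq_zero, ← integral_sub (hint hr.pos_part l)
      (hint hr'.pos_part l), ← h l]
    refine integral_congr_ae (ae_of_all _ fun x => ?_)
    simp only [Pi.neg_apply]
    rw [← mul_sub, ← Complex.ofReal_sub]
    congr 2
    rcases le_total 0 (r x) with hx | hx
    · rw [max_eq_left hx, max_eq_right (by linarith)]; ring
    · rw [max_eq_right hx, max_eq_left (by linarith)]; ring
  rw [withDensity_eq_iff hr.aestronglyMeasurable.aemeasurable.ennreal_ofReal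
    hr'.aestronglyMeasurable.aemeasurable.ennreal_ofReal
    hr.lintegral_lt_top.ne] at heq
  filter_upwards [heq] with x hx
  simp only [Pi.neg_apply] at hx
  rcases le_total 0 (r x) with hx0 | hx0
  · rw [ENNReal.ofReal_of_nonpos (p := -r x) (by linarith), ENNReal.ofReal_eq_zero] at hx
    exact le_antisymm hx hx0
  · rw [ENNReal.ofReal_of_nonpos hx0, eq_comm, ENNReal.ofReal_eq_zero] at hx
    exact le_antisymm hx0 (neg_nonpos.1 hx)

/-- An integrable function whose Fourier transform vanishes is zero almost everywhere. -/
theorem ae_eq_zero_of_integral_exp_mul {g : E → ℂ} (hg : Integrable g μ)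
    (h : ∀ l : E →L[ℝ] ℝ, ∫ x, Complex.exp (l x * Complex.I) * g x ∂μ = 0) : g =ᵐ[μ] 0 := by
  have hint : ∀ {q : E → ℂ}, Integrable q μ → ∀ l : E →L[ℝ] ℝ,
      Integrable (fun x => Complex.exp (l x * Complex.I) * q x) μ := by
    intro q hq l
    refine hq.bdd_mul (c := 1) (by fun_prop) (ae_of_all _ fun x => ?_)
    rw [Complex.norm_exp_ofReal_mul_I]
  have hgc : Integrable (fun x => conj (g x)) μ :=
    (Complex.conjCLE.toContinuousLinearMap.integrable_comp hg :)
  have hc : ∀ l : E →L[ℝ] ℝ, ∫ x, Complex.exp (l x * Complex.I) * conj (g x) ∂μ = 0 := by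
    intro l
    have h1 := congrArg conj (h (-l))
    rw [map_zero, ← integral_conj] at h1
    rw [← h1]
    refine integral_congr_ae (ae_of_all _ fun x => ?_)
    simp [← Complex.exp_conj]
  have hre : (fun x => (g x).re) =ᵐ[μ] 0 := by
    refine ae_eq_zero_of_integral_exp_mul_ofReal hg.re fun l => ?_
    have e : ∀ x, Complex.exp (l x * Complex.I) * ((g x).re : ℂ) =
        1 / 2 * (Complex.exp (l x * Complex.I) * g x +
          Complex.exp (l x * Complex.I) * conj (g x)) := fun x => by
      rw [Complex.re_eq_add_conj]; ring
    simp_rw [e]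
    rw [integral_const_mul, integral_add (hint hg l) (hint hgc l), h, hc]
    simp
  have him : (fun x => (g x).im) =ᵐ[μ] 0 := by
    refine ae_eq_zero_of_integral_exp_mul_ofReal hg.im fun l => ?_
    have e : ∀ x, Complex.exp (l x * Complex.I) * ((g x).im : ℂ) =
        1 / (2 * Complex.I) * (Complex.exp (l x * Complex.I) * g x -
          Complex.exp (l x * Complex.I) * conj (g x)) := fun x => by
      rw [Complex.im_eq_sub_conj]; ring
    simp_rw [e]
    rw [integral_const_mul, integral_sub (hint hg l) (hint hgc l), h, hc]
    simp
  filter_upwards [hre, him] with x hx hy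
  exact Complex.ext hx hy

end CharFun

lemma norm_ground (z : Fin n → ℂ) : ‖ground n z‖ = Real.exp (-(1 / 2) * absSq z) := by
  rw [ground, gaussian_apply, Complex.norm_real, Real.norm_of_nonneg (Real.exp_pos _).le]

/-- The exponential costs only part of the Gaussian: `|l z| - |z|²/2 ≤ ‖l‖² - |z|²/4`. The remaining
factor is in `L²`, and so is `u`. This dominates the exponential series termwise. -/
lemma integrable_exp_mul_ground_mul (l : (Fin n → ℂ) →L[ℝ] ℝ) (u : L2 n) :
    Integrable (fun z => Real.exp |l z| * ‖ground n z * u z‖) := by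
  have hG : MemLp (fun z : Fin n → ℂ => Real.exp |l z| * Real.exp (-(1 / 2) * absSq z)) 2 := by
    have h4 : (0 : ℝ) < 1 / 4 := by norm_num
    refine MemLp.of_le_mul (c := Real.exp (‖l‖ ^ 2)) ((gaussian n (1 / 4) h4).memLp 2) ?_
      (ae_of_all _ fun z => ?_)
    · have := contDiff_absSq (n := n).continuous
      exact Continuous.aestronglyMeasurable (by fun_prop)
    · rw [gaussian_apply, Complex.norm_real, Real.norm_of_nonneg (Real.exp_pos _).le,
        Real.norm_of_nonneg (by positivity), ← Real.exp_add, ← Real.exp_add]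
      refine Real.exp_le_exp.2 ?_
      have h1 : |l z| ≤ ‖l‖ * ‖z‖ := l.le_opNorm z
      have h2 := norm_sq_le_absSq z
      nlinarith [_root_.sq_nonneg (‖l‖ - ‖z‖ / 2)]
  have h := MemLp.integrable_mul hG (Lp.memLp u).norm
  refine h.congr (ae_of_all _ fun z => ?_)
  simp only [Pi.mul_apply, norm_mul, norm_ground]
  ring

/-- The excited states are complete. -/
theorem eq_zero_of_inner_excited {u : L2 n}
    (h : ∀ s : Multiset (Mode n), inner ℂ (toL2 n (excited s)) u = 0) : u = 0 := by
  have hspan : ∀ f ∈ excitedSpan n, inner ℂ (toL2 n f) u = 0 := by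
    intro f hf
    induction hf using Submodule.span_induction with
    | mem f hf => obtain ⟨s, rfl⟩ := hf; exact h s
    | zero => rw [map_zero, inner_zero_left]
    | add f g _ _ hf hg => rw [map_add, inner_add_left, hf, hg, add_zero]
    | smul c f _ hf => rw [map_smul, inner_smul_left, hf, mul_zero]
  have hmeas : AEStronglyMeasurable (fun z => ground n z * u z) volume :=
    (ground n).continuous.aestronglyMeasurable.mul (Lp.aestronglyMeasurable u)
  have hground : ∀ z, conj (ground n z) = ground n z := fun z => by
    rw [ground, gaussian_apply, Complex.conj_ofReal]
  have hmom : ∀ (l : (Fin n → ℂ) →L[ℝ] ℝ) (k : ℕ),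
      ∫ z, (l z : ℂ) ^ k * (ground n z * u z) = 0 := by
    intro l k
    obtain ⟨g, hg, hgz⟩ := exists_mem_excitedSpan_pow l k
    rw [← hspan g hg, inner_toL2_left]
    refine integral_congr_ae (ae_of_all _ fun z => ?_)
    simp only [hgz, map_mul, map_pow, Complex.conj_ofReal, hground]
    ring
  have hint : Integrable (fun z => ground n z * u z) := by
    have := integrable_exp_mul_ground_mul (0 : (Fin n → ℂ) →L[ℝ] ℝ) u
    simp only [zero_apply, abs_zero, Real.exp_zero, one_mul] at this
    exact (integrable_norm_iff hmeas).1 this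
  have hzero : (fun z => ground n z * u z) =ᵐ[volume] 0 := by
    refine ae_eq_zero_of_integral_exp_mul hint fun l => ?_
    -- Expanding the exponential writes the Fourier transform of `ground n * u` as a series of
    -- moments, all of which vanish by `hmom`.
    have hs := hasSum_integral_of_dominated_convergence (μ := (volume : Measure (Fin n → ℂ)))
      (F := fun (k : ℕ) z => (l z * Complex.I) ^ k / k.factorial * (ground n z * u z))
      (f := fun z => Complex.exp (l z * Complex.I) * (ground n z * u z))
      (fun (k : ℕ) z => |l z| ^ k / k.factorial * ‖ground n z * u z‖)
      (fun k => (Continuous.aestronglyMeasurable (by fun_prop)).mul hmeas)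
      (fun k => ae_of_all _ fun z => by simp)
      (ae_of_all _ fun z => (Real.summable_pow_div_factorial _).mul_right _)
      (by
        have : ∀ z, ∑' k : ℕ, |l z| ^ k / k.factorial * ‖ground n z * u z‖ =
            Real.exp |l z| * ‖ground n z * u z‖ := fun z => by
          rw [tsum_mul_right, Real.exp_eq_exp_ℝ, NormedSpace.exp_eq_tsum_div]
        simp_rw [this]
        exact integrable_exp_mul_ground_mul l u)
      (ae_of_all _ fun z => by
        have := NormedSpace.expSeries_div_hasSum_exp (l z * Complex.I)
        rw [← Complex.exp_eq_exp_ℂ] at this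
        exact this.mul_right _)
    refine hs.unique ?_
    convert hasSum_zero using 2 with k
    have e : ∀ z, (l z * Complex.I) ^ k / k.factorial * (ground n z * u z) =
        Complex.I ^ k / k.factorial * ((l z : ℂ) ^ k * (ground n z * u z)) := fun z => by ring
    simp_rw [e]
    rw [integral_const_mul, hmom, mul_zero]
  rw [Lp.eq_zero_iff_ae_eq_zero]
  filter_upwards [hzero] with z hz
  have : ground n z ≠ 0 := by
    rw [← norm_ne_zero_iff, norm_ground]
    exact (Real.exp_pos _).ne'
  exact (mul_eq_zero.1 hz).resolve_left this

/-! ### Diagonalisation of the Landau Hamiltonian and of its square root. -/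

/-- The normalised excited states. -/
def state (s : Multiset (Mode n)) : L2 n :=
  ((‖toL2 n (excited s)‖⁻¹ : ℝ) : ℂ) • toL2 n (excited s)

lemma orthonormal_state : Orthonormal ℂ (state (n := n)) := by
  refine ⟨fun s => ?_, fun s t h => ?_⟩
  · rw [state, norm_smul, Complex.norm_real, norm_inv, norm_norm]
    exact inv_mul_cancel₀ (norm_ne_zero_iff.2 (toL2_excited_ne_zero s))
  · simp only [state, inner_smul_left, inner_smul_right, inner_excited_of_ne h, mul_zero]

/-- The Hilbert basis of eigenfunctions. -/
def stateBasis (n : ℕ) : HilbertBasis (Multiset (Mode n)) ℂ (L2 n) :=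
  HilbertBasis.mkOfOrthogonalEqBot orthonormal_state (by
    rw [Submodule.eq_bot_iff]
    intro u hu
    refine eq_zero_of_inner_excited fun s => ?_
    have h1 := Submodule.inner_right_of_mem_orthogonal
      (Submodule.subset_span (Set.mem_range_self s)) hu
    rw [state, inner_smul_left, Complex.conj_ofReal] at h1
    refine (mul_eq_zero.1 h1).resolve_left ?_
    exact Complex.ofReal_ne_zero.2
      (inv_ne_zero (norm_ne_zero_iff.2 (toL2_excited_ne_zero s))))

@[simp] lemma stateBasis_apply (s : Multiset (Mode n)) : stateBasis n s = state s :=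
  congrFun (HilbertBasis.coe_mkOfOrthogonalEqBot _ _) s

lemma IsTest.of_schwartz {φ : 𝓢(Fin n → ℂ, ℂ)} (h : HasCompactSupport φ) :
    IsTest (φ : (Fin n → ℂ) → ℂ) := ⟨φ.smooth ⊤, h⟩

/-- A test function as a Schwartz function. -/
def IsTest.toSchwartz {φ : (Fin n → ℂ) → ℂ} (h : IsTest φ) : 𝓢(Fin n → ℂ, ℂ) :=
  h.2.toSchwartzMap h.1

@[simp] lemma IsTest.coe_toSchwartz {φ : (Fin n → ℂ) → ℂ} (h : IsTest φ) :
    (h.toSchwartz : (Fin n → ℂ) → ℂ) = φ := rfl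

/-- The weak form of `ℒ u = f` extends from test functions to Schwartz functions. -/
theorem hasImage_iff_schwartz (u f : L2 n) : HasImage u f ↔
    ∀ g : 𝓢(Fin n → ℂ, ℂ), inner ℂ (toL2 n (laplaceS n g)) u = inner ℂ (toL2 n g) f := by
  constructor
  · intro h g
    obtain ⟨φ, hφ, hlim⟩ := exists_seq_hasCompactSupport_tendsto g
    have h1 : Tendsto (fun k => inner ℂ (toL2 n (laplaceS n (φ k))) u) atTop
        (𝓝 (inner ℂ (toL2 n (laplaceS n g)) u)) :=
      ((((toL2 n).continuous.comp (laplaceS n).continuous).tendsto g).comp hlim).inner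
        tendsto_const_nhds
    have h2 : Tendsto (fun k => inner ℂ (toL2 n (φ k)) f) atTop (𝓝 (inner ℂ (toL2 n g) f)) :=
      (((toL2 n).continuous.tendsto g).comp hlim).inner tendsto_const_nhds
    refine tendsto_nhds_unique h1 (h2.congr fun k => ?_)
    rw [inner_toL2_left, inner_toL2_left, coe_laplaceS]
    exact (h _ (IsTest.of_schwartz (hφ k))).symm
  · intro h φ hφ
    have := h hφ.toSchwartz
    rwa [inner_toL2_left, inner_toL2_left, coe_laplaceS] at this

theorem hasImage_toL2 (f : 𝓢(Fin n → ℂ, ℂ)) : HasImage (toL2 n f) (toL2 n (laplaceS n f)) :=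
  (hasImage_iff_schwartz _ _).2 fun g => inner_laplaceS g f

lemma mem_eigenspace_iff {μ : ℝ} {u : L2 n} :
    u ∈ eigenspace n μ ↔ HasImage u ((μ : ℂ) • u) := Iff.rfl

theorem state_mem_eigenspace (s : Multiset (Mode n)) : state s ∈ eigenspace n (energy s) := by
  refine Submodule.smul_mem _ _ ?_
  rw [mem_eigenspace_iff, ← map_smul, ← laplaceS_excited]
  exact hasImage_toL2 _

lemma inner_state_laplaceS (s : Multiset (Mode n)) (f : 𝓢(Fin n → ℂ, ℂ)) :
    inner ℂ (state s) (toL2 n (laplaceS n f)) = energy s * inner ℂ (state s) (toL2 n f) := by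
  simp only [state, inner_smul_left, ← inner_laplaceS, laplaceS_excited, map_smul,
    Complex.conj_ofReal]
  ring

lemma inner_excited_eq_zero_iff (s : Multiset (Mode n)) (u : L2 n) :
    inner ℂ (toL2 n (excited s)) u = 0 ↔ inner ℂ (state s) u = 0 := by
  have : ((‖toL2 n (excited s)‖⁻¹ : ℝ) : ℂ) ≠ 0 := Complex.ofReal_ne_zero.2
    (inv_ne_zero (norm_ne_zero_iff.2 (toL2_excited_ne_zero s)))
  rw [state, inner_smul_left, Complex.conj_ofReal, mul_eq_zero, or_iff_right this]

theorem hasSum_state (u : L2 n) :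
    HasSum (fun s : Multiset (Mode n) => inner ℂ (state s) u • state s) u := by
  have := (stateBasis n).hasSum_repr u
  simpa only [HilbertBasis.repr_apply_apply, stateBasis_apply] using this

theorem ext_state {u v : L2 n}
    (h : ∀ s : Multiset (Mode n), inner ℂ (state s) u = inner ℂ (state s) v) : u = v := by
  refine (hasSum_state u).unique ?_
  simp_rw [h]
  exact hasSum_state v

/-- The eigenspaces in terms of the coefficients in the basis of eigenfunctions. -/
theorem mem_eigenspace_iff_inner_state {μ : ℝ} {u : L2 n} : u ∈ eigenspace n μ ↔
    ∀ s : Multiset (Mode n), energy s ≠ μ → inner ℂ (state s) u = 0 := by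
  constructor
  · intro hu s hs
    -- Tested on an eigenfunction, the weak equation reads `(energy s - μ) * ⟪excited s, u⟫ = 0`.
    have h1 := (hasImage_iff_schwartz _ _).1 hu (excited s)
    rw [laplaceS_excited, map_smul, inner_smul_left, inner_smul_right, Complex.conj_ofReal,
      ← sub_eq_zero, ← sub_mul, ← Complex.ofReal_sub] at h1
    rw [← inner_excited_eq_zero_iff]
    exact (mul_eq_zero.1 h1).resolve_left (Complex.ofReal_ne_zero.2 (sub_ne_zero.2 hs))
  · intro h
    refine (isClosed_eigenspace n μ).mem_of_tendsto (hasSum_state u)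
      (Eventually.of_forall fun F => Submodule.sum_mem _ fun s _ => ?_)
    by_cases hs : energy s = μ
    · exact Submodule.smul_mem _ _ (hs ▸ state_mem_eigenspace s)
    · rw [h s hs, zero_smul]
      exact zero_mem _

lemma inner_state_starProjection (s : Multiset (Mode n)) (μ : ℝ) (u : L2 n) :
    inner ℂ (state s) ((eigenspace n μ).starProjection u) =
      if energy s = μ then inner ℂ (state s) u else 0 := by
  split_ifs with h
  · have hs : state s ∈ eigenspace n μ := h ▸ state_mem_eigenspace s
    rw [← Submodule.inner_starProjection_left_eq_right,
      Submodule.starProjection_eq_self_iff.2 hs]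
  · exact mem_eigenspace_iff_inner_state.1
      (Submodule.starProjection_apply_mem _ _) s h

lemma energy_mem_eigenvalues (s : Multiset (Mode n)) : energy s ∈ eigenvalues n := by
  intro h
  have h1 := state_mem_eigenspace s
  rw [h, Submodule.mem_bot] at h1
  have := orthonormal_state.1 s
  rw [h1, norm_zero] at this
  exact zero_ne_one this

theorem mem_eigenvalues_iff {μ : ℝ} :
    μ ∈ eigenvalues n ↔ ∃ s : Multiset (Mode n), energy s = μ := by
  refine ⟨fun h => ?_, fun ⟨s, hs⟩ => hs ▸ energy_mem_eigenvalues s⟩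
  by_contra! hc
  refine h ((Submodule.eq_bot_iff _).2 fun u hu => ?_)
  refine ext_state fun s => ?_
  rw [mem_eigenspace_iff_inner_state.1 hu s (hc s), inner_zero_right]

/-- The square root of the Landau Hamiltonian is diagonal in the basis of eigenfunctions. -/
theorem hasSqrtImage_iff {u v : L2 n} : HasSqrtImage u v ↔
    ∀ s : Multiset (Mode n), inner ℂ (state s) v = (√(energy s) : ℝ) * inner ℂ (state s) u := by
  constructor
  · intro h s
    have h1 : HasSum (fun μ : eigenvalues n => inner ℂ (state s)
        (((√(μ : ℝ) : ℝ) : ℂ) • (eigenspace n μ).starProjection u)) (inner ℂ (state s) v) :=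
      h.mapL (innerSL ℂ (state s))
    refine h1.unique ?_
    convert hasSum_single (⟨energy s, energy_mem_eigenvalues s⟩ : eigenvalues n) ?_ using 1
    · rw [inner_smul_right, inner_state_starProjection, if_pos rfl]
    · intro μ hμ
      rw [inner_smul_right, inner_state_starProjection, if_neg, mul_zero]
      exact fun h => hμ (Subtype.ext h.symm)
  · intro h
    have hterm : ∀ μ : eigenvalues n, ((√(μ : ℝ) : ℝ) : ℂ) • (eigenspace n μ).starProjection u =
        (eigenspace n μ).starProjection v := by
      intro μ
      refine ext_state fun s => ?_
      rw [inner_smul_right, inner_state_starProjection, inner_state_starProjection]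
      split_ifs with hs
      · rw [h s, hs]
      · rw [mul_zero]
    rw [HasSqrtImage]
    simp_rw [hterm]
    -- The basis expansion of `v` is summed by blocks of equal energy; the block of `μ` sums to the
    -- projection of `v`.
    let κ : Multiset (Mode n) → eigenvalues n := fun s => ⟨energy s, energy_mem_eigenvalues s⟩
    have h1 := (Equiv.sigmaFiberEquiv κ).hasSum_iff.2 (hasSum_state v)
    refine h1.sigma fun μ => ?_
    have h2 := hasSum_state ((eigenspace n μ).starProjection v)
    have h3 : Function.support (fun s => inner ℂ (state s) ((eigenspace n μ).starProjection v) •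
        state s) ⊆ {s | κ s = μ} := by
      intro s hs
      rw [Function.mem_support, inner_state_starProjection] at hs
      by_contra hc
      refine hs ?_
      rw [if_neg (fun h => hc (Subtype.ext h)), zero_smul]
    rw [← hasSum_subtype_iff_of_support_subset h3] at h2
    have h4 : (fun s : {s // κ s = μ} => inner ℂ (state s.1) v • state s.1) =
        (fun s => inner ℂ (state s) ((eigenspace n μ).starProjection v) • state s) ∘
          Subtype.val := by
      funext s
      rw [Function.comp_apply, inner_state_starProjection, if_pos (congrArg Subtype.val s.2)]
    change HasSum (fun s : {s // κ s = μ} => inner ℂ (state s.1) v • state s.1) _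
    rw [h4]
    exact h2

lemma energy_nonneg (s : Multiset (Mode n)) : 0 ≤ energy s := by
  unfold energy
  positivity

lemma le_energy (s : Multiset (Mode n)) : (n : ℝ) ≤ energy s := by
  unfold energy
  have : (0 : ℝ) ≤ ∑ j : Fin n, (s.count (Sum.inl j) : ℝ) := by positivity
  linarith

/-- Schwartz functions lie in the form domain. -/
theorem exists_hasSqrtImage (f : 𝓢(Fin n → ℂ, ℂ)) : ∃ v : L2 n, HasSqrtImage (toL2 n f) v ∧
    ‖v‖ ^ 2 = ∑ j : Fin n,
      (‖toL2 n (ann (Sum.inl j) f)‖ ^ 2 + ‖toL2 n (cre (Sum.inl j) f)‖ ^ 2) := by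
  let c : Multiset (Mode n) → ℂ := fun s =>
    (√(energy s) : ℝ) * inner ℂ (state s) (toL2 n f)
  -- Parseval for `⟪f, ℒ f⟫`: its terms are the `‖c s‖²`, so finiteness of the quadratic form makes
  -- `c` square summable.
  have hc : ∀ s, inner ℂ (toL2 n f) (state s) * inner ℂ (state s) (toL2 n (laplaceS n f)) =
      ((‖c s‖ ^ 2 : ℝ) : ℂ) := by
    intro s
    rw [inner_state_laplaceS, ← inner_conj_symm (toL2 n f) (state s)]
    simp only [c, norm_mul, mul_pow, Complex.norm_real, Real.norm_of_nonneg (Real.sqrt_nonneg _),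
      Real.sq_sqrt (energy_nonneg s), Complex.ofReal_mul, Complex.ofReal_pow, ← Complex.conj_mul']
    ring
  have hsum := (stateBasis n).hasSum_inner_mul_inner (toL2 n f) (toL2 n (laplaceS n f))
  simp only [stateBasis_apply, hc, inner_laplaceS_self] at hsum
  rw [Complex.hasSum_ofReal] at hsum
  have hmem : Memℓp c 2 := by
    rw [memℓp_gen_iff (by norm_num)]
    simpa using hsum.summable
  refine ⟨(stateBasis n).repr.symm ⟨c, hmem⟩, hasSqrtImage_iff.2 fun s => ?_, ?_⟩
  · rw [← stateBasis_apply, ← HilbertBasis.repr_apply_apply, LinearIsometryEquiv.apply_symm_apply,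
      stateBasis_apply]
  · rw [LinearIsometryEquiv.norm_map, ← hsum.tsum_eq]
    have := lp.norm_rpow_eq_tsum (p := 2) (by norm_num) (⟨c, hmem⟩ : lp (fun _ => ℂ) 2)
    simpa using this

/-! ### The spectrum and its multiplicities. -/

theorem isLeast_eigenvalues : IsLeast (eigenvalues n) (n : ℝ) := by
  refine ⟨mem_eigenvalues_iff.2 ⟨0, by simp [energy]⟩, fun μ hμ => ?_⟩
  obtain ⟨s, rfl⟩ := mem_eigenvalues_iff.1 hμ
  exact le_energy s

theorem finite_eigenvalues_inter (R : ℝ) : (eigenvalues n ∩ Set.Iic R).Finite := by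
  refine ((Set.finite_Iic ⌊R⌋₊).image fun k : ℕ => (n + 2 * k : ℝ)).subset ?_
  rintro μ ⟨hμ, hR⟩
  obtain ⟨s, rfl⟩ := mem_eigenvalues_iff.1 hμ
  refine ⟨∑ j : Fin n, s.count (Sum.inl j), ?_, by simp [energy]⟩
  rw [Set.mem_Iic] at hR ⊢
  refine Nat.le_floor ?_
  rw [energy] at hR
  have : (0 : ℝ) ≤ ∑ j : Fin n, (s.count (Sum.inl j) : ℝ) := by positivity
  push_cast
  linarith [n.cast_nonneg (α := ℝ)]

/-- Adding copies of an `inr` mode leaves the energy unchanged and yields infinitely many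
orthonormal states in the same eigenspace. -/
theorem not_finiteDimensional_eigenspace (hn : 1 ≤ n) {μ : ℝ} (hμ : μ ∈ eigenvalues n) :
    ¬ FiniteDimensional ℂ (eigenspace n μ) := by
  obtain ⟨s, rfl⟩ := mem_eigenvalues_iff.1 hμ
  intro hfin
  let i : Mode n := Sum.inr ⟨0, hn⟩
  let t : ℕ → Multiset (Mode n) := fun k => s + Multiset.replicate k i
  have ht : Function.Injective t := fun k l h => by
    have := congrArg Multiset.card h
    simpa [t] using this
  have he : ∀ k, energy (t k) = energy s := fun k => by
    simp [energy, t, i, Multiset.count_replicate]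
  let f : ℕ → eigenspace n (energy s) := fun k => ⟨state (t k), he k ▸ state_mem_eigenspace (t k)⟩
  have hf : LinearIndependent ℂ f := by
    have h1 : LinearIndependent ℂ fun k => state (t k) :=
      (orthonormal_state.comp t ht).linearIndependent
    exact LinearIndependent.of_comp (eigenspace n (energy s)).subtype h1
  have := hf.finite
  exact not_finite ℕ

theorem exists_hilbertBasis_eigenspace (hn : 1 ≤ n) :
    ∃ (e : HilbertBasis ℕ ℂ (L2 n)) (lam : ℕ → ℝ), ∀ k : ℕ, e k ∈ eigenspace n (lam k) := by
  have : Nonempty (Mode n) := ⟨Sum.inr ⟨0, hn⟩⟩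
  have : Infinite (Multiset (Mode n)) := inferInstance
  have : Countable (Multiset (Mode n)) := inferInstance
  obtain ⟨ε⟩ := nonempty_equiv_of_countable (α := Multiset (Mode n)) (β := ℕ)
  have hsp : ⊤ ≤ (Submodule.span ℂ (Set.range fun k => state (ε.symm k))).topologicalClosure := by
    have h := (stateBasis n).dense_span
    have e : ⇑(stateBasis n) = state := funext stateBasis_apply
    rw [e] at h
    rw [← h, ← ε.symm.surjective.range_comp state]
    rfl
  refine ⟨HilbertBasis.mk (orthonormal_state.comp _ ε.symm.injective) hsp,
    fun k => energy (ε.symm k), fun k => ?_⟩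
  rw [HilbertBasis.coe_mk]
  exact state_mem_eigenspace _

/-! ### The diamagnetic inequality. -/

section Diamagnetic

lemma fderiv_single_one (j : Fin n) (f : 𝓢(Fin n → ℂ, ℂ)) (z : Fin n → ℂ) :
    fderiv ℝ f z (Pi.single j 1) = ann (Sum.inl j) f z - cre (Sum.inl j) f z +
      Complex.I * (z j).im * f z := by
  have h1 : conj (z j) = (z j).re - (z j).im * Complex.I := by apply Complex.ext <;> simp
  have h2 : z j = (z j).re + (z j).im * Complex.I := (Complex.re_add_im _).symm
  simp only [ann_inl_apply, cre_inl_apply, Z, Zbar, dz, dzbar]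
  linear_combination (-(1 / 2) * f z) * h1 + (1 / 2 * f z) * h2

lemma fderiv_single_I (j : Fin n) (f : 𝓢(Fin n → ℂ, ℂ)) (z : Fin n → ℂ) :
    fderiv ℝ f z (Pi.single j Complex.I) =
      Complex.I * (ann (Sum.inl j) f z + cre (Sum.inl j) f z) - Complex.I * (z j).re * f z := by
  have h1 : conj (z j) = (z j).re - (z j).im * Complex.I := by apply Complex.ext <;> simp
  have h2 : z j = (z j).re + (z j).im * Complex.I := (Complex.re_add_im _).symm
  simp only [ann_inl_apply, cre_inl_apply, Z, Zbar, dz, dzbar]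
  linear_combination (-(1 / 2) * Complex.I * f z) * h1 + (-(1 / 2) * Complex.I * f z) * h2 +
    fderiv ℝ f z (Pi.single j Complex.I) * Complex.I_sq

lemma inner_I_mul_real_mul_self (a : ℂ) (x : ℝ) : inner ℝ a (Complex.I * x * a) = 0 := by
  rw [Complex.inner]
  simp
  ring

/-- The magnetic gradient, measured in the `ℓ¹` norm. -/
def magneticGrad (f : 𝓢(Fin n → ℂ, ℂ)) (z : Fin n → ℂ) : ℝ :=
  ∑ j : Fin n, (‖ann (Sum.inl j) f z‖ + ‖cre (Sum.inl j) f z‖)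

/-- The magnetic potential contributes an imaginary multiple of `f z`, which is orthogonal to `f z`
over the reals; only the `Z_j` and `Z̄_j` parts survive. -/
lemma abs_inner_fderiv_le (f : 𝓢(Fin n → ℂ, ℂ)) (z v : Fin n → ℂ) :
    |inner ℝ (f z) (fderiv ℝ f z v)| ≤ 2 * ‖f z‖ * magneticGrad f z * ‖v‖ := by
  let T : (Fin n → ℂ) →L[ℝ] ℝ := (innerSL ℝ (f z)).comp (fderiv ℝ f z)
  have hT : ∀ v, T v = inner ℝ (f z) (fderiv ℝ f z v) := fun v => rfl
  have h1 : ∀ j, |T (Pi.single j 1)| ≤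
      ‖f z‖ * (‖ann (Sum.inl j) f z‖ + ‖cre (Sum.inl j) f z‖) := by
    intro j
    rw [hT, fderiv_single_one, inner_add_right, inner_I_mul_real_mul_self, add_zero]
    refine (abs_real_inner_le_norm _ _).trans ?_
    gcongr
    exact norm_sub_le _ _
  have h2 : ∀ j, |T (Pi.single j Complex.I)| ≤
      ‖f z‖ * (‖ann (Sum.inl j) f z‖ + ‖cre (Sum.inl j) f z‖) := by
    intro j
    rw [hT, fderiv_single_I, inner_sub_right, inner_I_mul_real_mul_self, sub_zero]
    refine (abs_real_inner_le_norm _ _).trans ?_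
    rw [norm_mul, Complex.norm_I, one_mul]
    gcongr
    exact norm_add_le _ _
  rw [← hT, real_form_apply, magneticGrad, Finset.mul_sum, Finset.sum_mul]
  refine (Finset.abs_sum_le_sum_abs _ _).trans (Finset.sum_le_sum fun j _ => ?_)
  refine (abs_add_le _ _).trans ?_
  rw [abs_mul, abs_mul]
  have h3 : |(v j).re| ≤ ‖v‖ := (Complex.abs_re_le_norm _).trans (norm_le_pi_norm v j)
  have h4 : |(v j).im| ≤ ‖v‖ := (Complex.abs_im_le_norm _).trans (norm_le_pi_norm v j)
  calc _ ≤ ‖v‖ * (‖f z‖ * (‖ann (Sum.inl j) f z‖ + ‖cre (Sum.inl j) f z‖)) +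
        ‖v‖ * (‖f z‖ * (‖ann (Sum.inl j) f z‖ + ‖cre (Sum.inl j) f z‖)) := by
          gcongr
          · exact h1 j
          · exact h2 j
    _ = _ := by ring

lemma magneticGrad_nonneg (f : 𝓢(Fin n → ℂ, ℂ)) (z : Fin n → ℂ) : 0 ≤ magneticGrad f z :=
  Finset.sum_nonneg fun _ _ => by positivity

/-- The diamagnetic inequality for powers of the modulus. -/
theorem norm_fderiv_norm_rpow_le_magneticGrad (f : 𝓢(Fin n → ℂ, ℂ)) {s : ℝ} (hs : 1 < s)
    (z : Fin n → ℂ) : ‖fderiv ℝ (fun x => ‖f x‖ ^ s) z‖ ≤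
      2 * s * (‖f z‖ ^ (s - 1) * magneticGrad f z) := by
  have hG := magneticGrad_nonneg f z
  have hs0 : 0 < s := by linarith
  rw [f.differentiable.fderiv_norm_rpow hs]
  refine ContinuousLinearMap.opNorm_le_bound _ (by positivity) fun v => ?_
  have e : ((s * ‖f z‖ ^ (s - 2)) • (innerSL ℝ (f z)).comp (fderiv ℝ f z)) v =
      s * ‖f z‖ ^ (s - 2) * inner ℝ (f z) (fderiv ℝ f z v) := rfl
  rw [e, Real.norm_eq_abs, abs_mul, abs_of_nonneg (by positivity)]
  have h := abs_inner_fderiv_le f z v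
  rcases eq_or_ne (f z) 0 with h0 | h0
  -- Zeros of `f` are treated apart, because the exponent `s - 2` may be negative.
  · simp only [h0, inner_zero_left, abs_zero, mul_zero]
    positivity
  · have e2 : ‖f z‖ ^ (s - 1) = ‖f z‖ ^ (s - 2) * ‖f z‖ := by
      rw [← Real.rpow_add_one (norm_ne_zero_iff.2 h0)]
      congr 1
      ring
    calc _ ≤ s * ‖f z‖ ^ (s - 2) * (2 * ‖f z‖ * magneticGrad f z * ‖v‖) := by gcongr
      _ = _ := by rw [e2]; ring

end Diamagnetic

/-! ### Sobolev and Gagliardo–Nirenberg inequalities for compactly supported functions. -/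

/-- The square root of the quadratic form of the Landau Hamiltonian. -/
def formNorm (f : 𝓢(Fin n → ℂ, ℂ)) : ℝ :=
  √(∑ j : Fin n, (‖toL2 n (ann (Sum.inl j) f)‖ ^ 2 + ‖toL2 n (cre (Sum.inl j) f)‖ ^ 2))

lemma norm_ann_le_formNorm (f : 𝓢(Fin n → ℂ, ℂ)) (j : Fin n) :
    ‖toL2 n (ann (Sum.inl j) f)‖ ≤ formNorm f := by
  refine Real.le_sqrt_of_sq_le ?_
  refine le_trans ?_ (Finset.single_le_sum (f := fun j : Fin n =>
    ‖toL2 n (ann (Sum.inl j) f)‖ ^ 2 + ‖toL2 n (cre (Sum.inl j) f)‖ ^ 2)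
    (fun _ _ => by positivity) (Finset.mem_univ j))
  exact le_add_of_nonneg_right (by positivity)

lemma norm_cre_le_formNorm (f : 𝓢(Fin n → ℂ, ℂ)) (j : Fin n) :
    ‖toL2 n (cre (Sum.inl j) f)‖ ≤ formNorm f := by
  refine Real.le_sqrt_of_sq_le ?_
  refine le_trans ?_ (Finset.single_le_sum (f := fun j : Fin n =>
    ‖toL2 n (ann (Sum.inl j) f)‖ ^ 2 + ‖toL2 n (cre (Sum.inl j) f)‖ ^ 2)
    (fun _ _ => by positivity) (Finset.mem_univ j))
  exact le_add_of_nonneg_left (by positivity)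

/-- The integral of `|f|^q`. -/
def powInt (f : 𝓢(Fin n → ℂ, ℂ)) (q : ℝ) : ENNReal := ∫⁻ z, ‖f z‖ₑ ^ q

lemma eLpNorm_eq_powInt (f : 𝓢(Fin n → ℂ, ℂ)) {q : ℝ} (hq : 0 < q) :
    eLpNorm f (ENNReal.ofReal q) volume = powInt f q ^ (1 / q) := by
  rw [eLpNorm_eq_lintegral_rpow_enorm_toReal (by simpa using hq) ENNReal.ofReal_ne_top,
    ENNReal.toReal_ofReal hq.le, powInt]

lemma powInt_ne_top (f : 𝓢(Fin n → ℂ, ℂ)) {q : ℝ} (hq : 0 < q) : powInt f q ≠ ⊤ := by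
  have h := (f.memLp (ENNReal.ofReal q) volume).eLpNorm_ne_top
  rw [eLpNorm_eq_powInt f hq] at h
  intro hc
  rw [hc, ENNReal.top_rpow_of_pos (by positivity)] at h
  exact h rfl

lemma powInt_two_rpow (f : 𝓢(Fin n → ℂ, ℂ)) :
    powInt f 2 ^ (1 / 2 : ℝ) = ENNReal.ofReal ‖toL2 n f‖ := by
  rw [← eLpNorm_eq_powInt f two_pos, ENNReal.ofReal_ofNat, ofReal_norm, Lp.enorm_def,
    eLpNorm_congr_ae (coeFn_toL2 f)]

lemma lintegral_rpow_mul_le (f g : 𝓢(Fin n → ℂ, ℂ)) (s : ℝ) {q : ℝ} (hq : ‖toL2 n g‖ ≤ q) :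
    ∫⁻ z, ‖f z‖ₑ ^ (s - 1) * ‖g z‖ₑ ≤
      powInt f (2 * (s - 1)) ^ (1 / 2 : ℝ) * ENNReal.ofReal q := by
  have h := ENNReal.lintegral_mul_le_Lp_mul_Lq (volume : Measure (Fin n → ℂ))
    Real.HolderConjugate.two_two (f := fun z => ‖f z‖ₑ ^ (s - 1)) (g := fun z => ‖g z‖ₑ)
    (f.continuous.enorm.measurable.pow_const _).aemeasurable g.continuous.enorm.aemeasurable
  simp only [Pi.mul_apply, ← ENNReal.rpow_mul] at h
  refine h.trans ?_
  have e : (s - 1) * 2 = 2 * (s - 1) := by ring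
  rw [e]
  refine mul_le_mul' le_rfl ?_
  refine le_trans (le_of_eq (powInt_two_rpow g)) (ENNReal.ofReal_le_ofReal hq)

lemma lintegral_fderiv_norm_rpow_le (f : 𝓢(Fin n → ℂ, ℂ)) {s : ℝ} (hs : 1 < s) :
    ∫⁻ z, ‖fderiv ℝ (fun x => ‖f x‖ ^ s) z‖ₑ ≤ ENNReal.ofReal (2 * s) * ((2 * n : ℕ) *
      (powInt f (2 * (s - 1)) ^ (1 / 2 : ℝ) * ENNReal.ofReal (formNorm f))) := by
  have hpt : ∀ z, ‖fderiv ℝ (fun x => ‖f x‖ ^ s) z‖ₑ ≤ ENNReal.ofReal (2 * s) *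
      ∑ j : Fin n, (‖f z‖ₑ ^ (s - 1) * ‖ann (Sum.inl j) f z‖ₑ +
        ‖f z‖ₑ ^ (s - 1) * ‖cre (Sum.inl j) f z‖ₑ) := by
    intro z
    have h := ENNReal.ofReal_le_ofReal (norm_fderiv_norm_rpow_le_magneticGrad f hs z)
    rw [ofReal_norm, ENNReal.ofReal_mul (by linarith)] at h
    refine h.trans (le_of_eq ?_)
    congr 1
    rw [ENNReal.ofReal_mul (by positivity), magneticGrad,
      ENNReal.ofReal_sum_of_nonneg (fun _ _ => by positivity), Finset.mul_sum,
      ← ENNReal.ofReal_rpow_of_nonneg (norm_nonneg _) (by linarith), ofReal_norm]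
    refine Finset.sum_congr rfl fun j _ => ?_
    rw [ENNReal.ofReal_add (norm_nonneg _) (norm_nonneg _), ofReal_norm,
      ofReal_norm, mul_add]
  have hm : ∀ g : 𝓢(Fin n → ℂ, ℂ), Measurable fun z => ‖f z‖ₑ ^ (s - 1) * ‖g z‖ₑ := fun g =>
    (f.continuous.enorm.measurable.pow_const _).mul g.continuous.enorm.measurable
  have hm2 : ∀ j : Fin n, Measurable fun z => ‖f z‖ₑ ^ (s - 1) * ‖ann (Sum.inl j) f z‖ₑ +
      ‖f z‖ₑ ^ (s - 1) * ‖cre (Sum.inl j) f z‖ₑ := fun j => (hm _).add (hm _)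
  refine (lintegral_mono hpt).trans ?_
  rw [lintegral_const_mul _ (Finset.measurable_fun_sum _ fun j _ => hm2 j)]
  refine mul_le_mul' le_rfl ?_
  rw [lintegral_finsetSum _ fun j _ => hm2 j]
  set X := powInt f (2 * (s - 1)) ^ (1 / 2 : ℝ) * ENNReal.ofReal (formNorm f)
  have : ∀ j : Fin n, ∫⁻ z, (‖f z‖ₑ ^ (s - 1) * ‖ann (Sum.inl j) f z‖ₑ +
        ‖f z‖ₑ ^ (s - 1) * ‖cre (Sum.inl j) f z‖ₑ) ≤ X + X := by
    intro j
    rw [lintegral_add_left (hm _)]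
    exact add_le_add (lintegral_rpow_mul_le f _ s (norm_ann_le_formNorm f j))
      (lintegral_rpow_mul_le f _ s (norm_cre_le_formNorm f j))
  refine (Finset.sum_le_sum fun j _ => this j).trans (le_of_eq ?_)
  rw [Finset.sum_const, Finset.card_univ, Fintype.card_fin, nsmul_eq_mul]
  push_cast
  ring

/-- The `L¹` Sobolev inequality applied to a power of the modulus. -/
theorem exists_powInt_le {s p : ℝ} (hs : 1 < s)
    (hp : Real.HolderConjugate (2 * n : ℕ) p) : ∃ K : ENNReal, K ≠ ⊤ ∧
      ∀ f : 𝓢(Fin n → ℂ, ℂ), HasCompactSupport f → powInt f (s * p) ≤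
        K * (powInt f (2 * (s - 1)) ^ (1 / 2 : ℝ) * ENNReal.ofReal (formNorm f)) ^ p := by
  have hfr : Module.finrank ℝ (Fin n → ℂ) = 2 * n := by
    rw [Module.finrank_pi_fintype]
    simp [Complex.finrank_real_complex, mul_comm]
  have hp0 : 0 < p := hp.symm.pos
  refine ⟨lintegralPowLePowLIntegralFDerivConst (volume : Measure (Fin n → ℂ)) p *
    (ENNReal.ofReal (2 * s) * (2 * n : ℕ)) ^ p, ?_, fun f hf => ?_⟩
  · exact ENNReal.mul_ne_top ENNReal.coe_ne_top (ENNReal.rpow_ne_top_of_nonneg hp0.le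
      (ENNReal.mul_ne_top ENNReal.ofReal_ne_top (ENNReal.natCast_ne_top _)))
  · have hw : ContDiff ℝ 1 fun x => ‖f x‖ ^ s := (f.smooth 1).norm_rpow hs
    have hwc : HasCompactSupport fun x => ‖f x‖ ^ s :=
      hf.comp_left (g := fun a : ℂ => ‖a‖ ^ s) (by simp [(by linarith : s ≠ 0)])
    rw [← hfr] at hp
    have h := lintegral_pow_le_pow_lintegral_fderiv (volume : Measure (Fin n → ℂ)) hw hwc hp
    have e : ∀ z, ‖‖f z‖ ^ s‖ₑ ^ p = ‖f z‖ₑ ^ (s * p) := fun z => by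
      rw [Real.enorm_rpow_of_nonneg (norm_nonneg _) (by linarith), enorm_norm, ENNReal.rpow_mul]
    simp_rw [e] at h
    refine h.trans ?_
    rw [mul_assoc, ← ENNReal.mul_rpow_of_nonneg _ _ hp0.le]
    gcongr
    rw [mul_assoc]
    exact lintegral_fderiv_norm_rpow_le f hs

/-- The Gagliardo–Nirenberg inequality with exponent `2p` for smooth functions with compact
support, in terms of integrals. -/
def PowIntInequality (n : ℕ) (p : ℝ) : Prop :=
  ∃ K : ENNReal, K ≠ ⊤ ∧ ∀ f : 𝓢(Fin n → ℂ, ℂ), HasCompactSupport f →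
    powInt f (2 * p) ≤ K * ENNReal.ofReal (formNorm f) ^ (2 * (n * (p - 1))) *
      powInt f 2 ^ (p - n * (p - 1))

/-- In real dimension two the Sobolev exponent is `2`, so `s = k + 2` gives `∫|f|^{2(k+2)} ≤ K' ·
∫|f|^{2(k+1)} · formNorm²`: each step raises the exponent by one at the cost of a squared form norm.
-/
lemma powIntInequality_succ_one (k : ℕ) : PowIntInequality 1 (k + 1) := by
  induction k with
  | zero => exact ⟨1, ENNReal.one_ne_top, fun f _ => by simp⟩
  | succ k ih =>
    obtain ⟨K, hK, h⟩ := ih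
    have hc : Real.HolderConjugate ((2 * 1 : ℕ) : ℝ) 2 := by
      norm_num
      exact Real.HolderConjugate.two_two
    obtain ⟨K', hK', h'⟩ := exists_powInt_le (n := 1) (s := k + 2) (p := 2)
      (by linarith [k.cast_nonneg (α := ℝ)]) hc
    refine ⟨K' * K, ENNReal.mul_ne_top hK' hK, fun f hf => ?_⟩
    have h1 := h f hf
    have h2 := h' f hf
    push_cast at h1 h2 ⊢
    have e1 : ((k : ℝ) + 2) * 2 = 2 * (k + 1 + 1) := by ring
    have e2 : 2 * ((k : ℝ) + 2 - 1) = 2 * (k + 1) := by ring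
    have e3 : 2 * (1 * ((k : ℝ) + 1 + 1 - 1)) = 2 * (1 * (k + 1 - 1)) + 2 := by ring
    have e4 : (k : ℝ) + 1 + 1 - 1 * (k + 1 + 1 - 1) = 1 := by ring
    have e5 : (k : ℝ) + 1 - 1 * (k + 1 - 1) = 1 := by ring
    rw [e1, e2, ENNReal.mul_rpow_of_nonneg _ _ zero_le_two, ← ENNReal.rpow_mul] at h2
    rw [e5] at h1
    rw [e3, e4, ENNReal.rpow_add_of_nonneg _ _ (by
      have := k.cast_nonneg (α := ℝ); linarith) zero_le_two]
    norm_num only at h2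
    rw [ENNReal.rpow_one] at h1 h2 ⊢
    calc _ ≤ _ := h2
      _ ≤ K' * (K * ENNReal.ofReal (formNorm f) ^ (2 * (1 * ((k : ℝ) + 1 - 1))) * powInt f 2 *
          ENNReal.ofReal (formNorm f) ^ (2 : ℝ)) := by gcongr
      _ = _ := by ring

/-- The value `s = (2n-1)/(n-1)` is the one for which `s · 2n/(2n-1) = 2(s-1)`, both equal to
`2n/(n-1)`. The same integral then stands on both sides, with a power below one on the right, and
can be divided out. -/
lemma powIntInequality_critical (hn : 2 ≤ n) : PowIntInequality n (n / (n - 1)) := by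
  have hn' : (2 : ℝ) ≤ n := by exact_mod_cast hn
  have hn1 : (0 : ℝ) < n - 1 := by linarith
  have hn2 : (0 : ℝ) < 2 * n - 1 := by linarith
  have hc : Real.HolderConjugate ((2 * n : ℕ) : ℝ) (2 * n / (2 * n - 1)) := by
    rw [Real.holderConjugate_iff]
    push_cast
    refine ⟨by linarith, ?_⟩
    field_simp
    ring
  obtain ⟨K, hK, h⟩ := exists_powInt_le (n := n) (s := (2 * n - 1) / (n - 1))
    (by rw [lt_div_iff₀ hn1]; linarith) hc
  have hr : (0 : ℝ) < 2 * (n / (n - 1)) := by positivity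
  let κ : ℝ := (2 * n - 1) / (n - 1)
  have hκ : 0 < κ := by positivity
  refine ⟨K ^ κ, ENNReal.rpow_ne_top_of_nonneg hκ.le hK, fun f hf => ?_⟩
  have h1 := h f hf
  have e1 : (2 * n - 1) / (n - 1) * (2 * n / (2 * n - 1)) = 2 * ((n : ℝ) / (n - 1)) := by
    field_simp
  have e2 : 2 * ((2 * (n : ℝ) - 1) / (n - 1) - 1) = 2 * ((n : ℝ) / (n - 1)) := by
    field_simp
    ring
  rw [e1, e2, ENNReal.mul_rpow_of_nonneg _ _ hc.symm.pos.le, ← ENNReal.rpow_mul] at h1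
  have e3 : (n : ℝ) / (n - 1) - n * (n / (n - 1) - 1) = 0 := by
    field_simp
    ring
  have e4 : 2 * ((n : ℝ) * (n / (n - 1) - 1)) = 2 * n / (2 * n - 1) * κ := by
    simp only [κ]
    field_simp
    ring
  rw [e3, ENNReal.rpow_zero, mul_one, e4, ENNReal.rpow_mul, ← ENNReal.mul_rpow_of_nonneg _ _ hκ.le]
  set I := powInt f (2 * (n / (n - 1)))
  -- The division needs `0 < I < ∞`; finiteness holds because `f` is a Schwartz function.
  rcases eq_or_ne I 0 with h0 | h0
  · rw [h0]; exact zero_le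
  have htop : I ≠ ⊤ := powInt_ne_top f hr
  have e5 : I = (I ^ (1 / 2 * (2 * (n : ℝ) / (2 * n - 1))) * I ^ κ⁻¹) := by
    rw [← ENNReal.rpow_add _ _ h0 htop]
    conv_lhs => rw [← ENNReal.rpow_one I]
    congr 1
    simp only [κ]
    field_simp
    ring
  have h2 : I ^ κ⁻¹ ≤ K * ENNReal.ofReal (formNorm f) ^ (2 * (n : ℝ) / (2 * n - 1)) := by
    have hne : I ^ (1 / 2 * (2 * (n : ℝ) / (2 * n - 1))) ≠ 0 := by
      rw [Ne, ENNReal.rpow_eq_zero_iff]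
      rintro (⟨h, -⟩ | ⟨h, -⟩)
      · exact h0 h
      · exact htop h
    have hnt : I ^ (1 / 2 * (2 * (n : ℝ) / (2 * n - 1))) ≠ ⊤ :=
      ENNReal.rpow_ne_top_of_nonneg (by positivity) htop
    refine (ENNReal.mul_le_mul_iff_right hne hnt).1 ?_
    rw [← e5]
    refine h1.trans (le_of_eq (by ring))
  calc I = (I ^ κ⁻¹) ^ κ := by rw [← ENNReal.rpow_mul, inv_mul_cancel₀ hκ.ne', ENNReal.rpow_one]
    _ ≤ _ := by gcongr

/-- Hölder's inequality between the exponents `2` and `2q`. The powers in the inequality are affine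
in `p`, so they interpolate exactly; the sign condition on `q - n(q - 1)` permits splitting powers
that may have base zero. -/
lemma PowIntInequality.interpolate {p q : ℝ} (hq1 : 1 < q) (hpq : p ≤ q) (hp1 : 1 ≤ p)
    (hq : 0 ≤ q - n * (q - 1)) (h : PowIntInequality n q) : PowIntInequality n p := by
  obtain ⟨K, hK, h⟩ := h
  let t : ℝ := (p - 1) / (q - 1)
  have hq0 : 0 < q - 1 := by linarith
  have ht0 : 0 ≤ t := div_nonneg (by linarith) hq0.le
  have ht1 : t ≤ 1 := (div_le_one hq0).2 (by linarith)
  have htp : t * (q - 1) = p - 1 := div_mul_cancel₀ _ hq0.ne'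
  refine ⟨K ^ t, ENNReal.rpow_ne_top_of_nonneg ht0 hK, fun f hf => ?_⟩
  have h1 := ENNReal.lintegral_mul_norm_pow_le (μ := (volume : Measure (Fin n → ℂ)))
    (f := fun z => ‖f z‖ₑ ^ (2 : ℝ)) (g := fun z => ‖f z‖ₑ ^ (2 * q))
    (f.continuous.enorm.measurable.pow_const _).aemeasurable
    (f.continuous.enorm.measurable.pow_const _).aemeasurable (sub_nonneg.2 ht1) ht0
    (sub_add_cancel _ _)
  have e1 : ∀ z, (‖f z‖ₑ ^ (2 : ℝ)) ^ (1 - t) * (‖f z‖ₑ ^ (2 * q)) ^ t = ‖f z‖ₑ ^ (2 * p) := by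
    intro z
    rw [← ENNReal.rpow_mul, ← ENNReal.rpow_mul, ← ENNReal.rpow_add_of_nonneg _ _
      (mul_nonneg zero_le_two (sub_nonneg.2 ht1)) (by positivity)]
    congr 1
    linear_combination 2 * htp
  simp_rw [e1] at h1
  have e2 : p - n * (p - 1) = (1 - t) + (q - n * (q - 1)) * t := by
    linear_combination (-1 + (n : ℝ)) * htp
  have e3 : 2 * (n * (p - 1)) = 2 * (n * (q - 1)) * t := by
    linear_combination (-(2 * n : ℝ)) * htp
  calc powInt f (2 * p) ≤ powInt f 2 ^ (1 - t) * powInt f (2 * q) ^ t := h1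
    _ ≤ powInt f 2 ^ (1 - t) * (K * ENNReal.ofReal (formNorm f) ^ (2 * (n * (q - 1))) *
      powInt f 2 ^ (q - n * (q - 1))) ^ t := by
        gcongr
        exact h f hf
    _ = _ := by
        rw [ENNReal.mul_rpow_of_nonneg _ _ ht0, ENNReal.mul_rpow_of_nonneg _ _ ht0,
          ← ENNReal.rpow_mul, ← ENNReal.rpow_mul, e2, e3, ENNReal.rpow_add_of_nonneg _ _
          (sub_nonneg.2 ht1) (mul_nonneg hq ht0)]
        ring

theorem powIntInequality (hn : 1 ≤ n) {p : ℝ} (hp : 1 ≤ p)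
    (hpn : n = 1 ∨ (2 ≤ n ∧ p ≤ (n : ℝ) / ((n : ℝ) - 1))) : PowIntInequality n p := by
  rcases hpn with rfl | ⟨hn2, hpn⟩
  · obtain ⟨k, hk⟩ := exists_nat_ge p
    refine (powIntInequality_succ_one (k + 1)).interpolate ?_ ?_ hp ?_
    · push_cast; linarith [k.cast_nonneg (α := ℝ)]
    · push_cast; linarith
    · push_cast; linarith
  · have hn' : (2 : ℝ) ≤ n := by exact_mod_cast hn2
    have hn1 : (0 : ℝ) < n - 1 := by linarith
    refine (powIntInequality_critical hn2).interpolate ?_ hpn hp ?_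
    · rw [lt_div_iff₀ hn1]; linarith
    · refine le_of_eq ?_
      field_simp
      ring

/-- The admissible exponents have interpolation parameter at most one. -/
lemma mul_sub_one_div_mem_Icc (hn : 1 ≤ n) {p : ℝ} (hp : 1 ≤ p)
    (hpn : n = 1 ∨ (2 ≤ n ∧ p ≤ (n : ℝ) / ((n : ℝ) - 1))) :
    (n : ℝ) * (p - 1) / p ∈ Set.Icc 0 1 := by
  have hp0 : 0 < p := by linarith
  have hp1 : 0 ≤ p - 1 := by linarith
  refine ⟨by positivity, (div_le_one hp0).2 ?_⟩
  rcases hpn with rfl | ⟨hn2, hpn⟩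
  · push_cast; linarith
  · have hn' : (2 : ℝ) ≤ n := by exact_mod_cast hn2
    have hn1 : (0 : ℝ) < n - 1 := by linarith
    rw [le_div_iff₀ hn1] at hpn
    linarith

lemma formNorm_nonneg (f : 𝓢(Fin n → ℂ, ℂ)) : 0 ≤ formNorm f := Real.sqrt_nonneg _

theorem exists_eLpNorm_le_of_hasCompactSupport (hn : 1 ≤ n) {p : ℝ} (hp : 1 ≤ p)
    (hpn : n = 1 ∨ (2 ≤ n ∧ p ≤ (n : ℝ) / ((n : ℝ) - 1))) :
    ∃ C : ℝ, 0 < C ∧ ∀ f : 𝓢(Fin n → ℂ, ℂ), HasCompactSupport f →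
      eLpNorm f (ENNReal.ofReal (2 * p)) volume ≤ ENNReal.ofReal
        (C * formNorm f ^ ((n : ℝ) * (p - 1) / p) * ‖toL2 n f‖ ^ (1 - (n : ℝ) * (p - 1) / p)) := by
  obtain ⟨K, hK, h⟩ := powIntInequality hn hp hpn
  obtain ⟨hθ0, hθ1⟩ := mul_sub_one_div_mem_Icc hn hp hpn
  have hp0 : 0 < p := by linarith
  have hr : 0 < 2 * p := by linarith
  have hr' : 0 ≤ 1 / (2 * p) := by positivity
  have hKt : K ^ (1 / (2 * p)) ≠ ⊤ := ENNReal.rpow_ne_top_of_nonneg hr' hK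
  -- The summand `1` only makes the constant positive.
  refine ⟨(K ^ (1 / (2 * p))).toReal + 1, by positivity, fun f hf => ?_⟩
  set θ := (n : ℝ) * (p - 1) / p with hθ
  have hf0 := formNorm_nonneg f
  rw [eLpNorm_eq_powInt f hr, ENNReal.ofReal_mul (by positivity), ENNReal.ofReal_mul (by positivity),
    ← ENNReal.ofReal_rpow_of_nonneg hf0 hθ0,
    ← ENNReal.ofReal_rpow_of_nonneg (norm_nonneg _) (sub_nonneg.2 hθ1), ← powInt_two_rpow]
  calc powInt f (2 * p) ^ (1 / (2 * p))
      ≤ (K * ENNReal.ofReal (formNorm f) ^ (2 * (n * (p - 1))) *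
      powInt f 2 ^ (p - n * (p - 1))) ^ (1 / (2 * p)) := by
        gcongr
        exact h f hf
    _ = K ^ (1 / (2 * p)) * ENNReal.ofReal (formNorm f) ^ θ *
        (powInt f 2 ^ (1 / 2 : ℝ)) ^ (1 - θ) := by
        rw [ENNReal.mul_rpow_of_nonneg _ _ hr', ENNReal.mul_rpow_of_nonneg _ _ hr',
          ← ENNReal.rpow_mul, ← ENNReal.rpow_mul, ← ENNReal.rpow_mul]
        have e1 : 2 * (n * (p - 1)) * (1 / (2 * p)) = θ := by rw [hθ]; field_simp
        have e2 : (p - n * (p - 1)) * (1 / (2 * p)) = 1 / 2 * (1 - θ) := by rw [hθ]; field_simp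
        rw [e1, e2]
    _ ≤ _ := by
        gcongr
        rw [← ENNReal.ofReal_toReal hKt]
        exact ENNReal.ofReal_le_ofReal (by rw [ENNReal.toReal_ofReal ENNReal.toReal_nonneg]; linarith)

/-! ### Extension to the form domain. -/

/-- Lower semicontinuity of the `Lʳ` norm under convergence in `L²`. -/
theorem eLpNorm_le_ofReal_of_tendsto {u : ℕ → L2 n} {u' : L2 n} (hu : Tendsto u atTop (𝓝 u'))
    {a : ℕ → ℝ} {a' : ℝ} (ha : Tendsto a atTop (𝓝 a')) {r : ENNReal}
    (h : ∀ k, eLpNorm (u k) r volume ≤ ENNReal.ofReal (a k)) :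
    eLpNorm u' r volume ≤ ENNReal.ofReal a' := by
  refine ENNReal.le_of_forall_pos_le_add fun ε hε _ => ?_
  refine eLpNorm_le_of_tendstoInMeasure ?_ (tendstoInMeasure_of_tendsto_Lp hu)
    fun k => Lp.aestronglyMeasurable _
  have hε' : a' < a' + ε := by simpa using hε
  filter_upwards [ha.eventually (gt_mem_nhds hε')] with k hk
  refine (h k).trans ((ENNReal.ofReal_le_ofReal hk.le).trans ?_)
  refine ENNReal.ofReal_add_le.trans (le_of_eq ?_)
  rw [ENNReal.ofReal_coe_nnreal]

lemma continuous_formNorm : Continuous (formNorm (n := n)) := by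
  refine Real.continuous_sqrt.comp (continuous_finsetSum _ fun j _ => ?_)
  exact ((((toL2 n).continuous.comp (ann (Sum.inl j)).continuous).norm).pow 2).add
    ((((toL2 n).continuous.comp (cre (Sum.inl j)).continuous).norm).pow 2)

theorem exists_eLpNorm_le_schwartz (hn : 1 ≤ n) {p : ℝ} (hp : 1 ≤ p)
    (hpn : n = 1 ∨ (2 ≤ n ∧ p ≤ (n : ℝ) / ((n : ℝ) - 1))) :
    ∃ C : ℝ, 0 < C ∧ ∀ f : 𝓢(Fin n → ℂ, ℂ),
      eLpNorm (toL2 n f) (ENNReal.ofReal (2 * p)) volume ≤ ENNReal.ofReal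
        (C * formNorm f ^ ((n : ℝ) * (p - 1) / p) * ‖toL2 n f‖ ^ (1 - (n : ℝ) * (p - 1) / p)) := by
  obtain ⟨C, hC, h⟩ := exists_eLpNorm_le_of_hasCompactSupport hn hp hpn
  obtain ⟨hθ0, hθ1⟩ := mul_sub_one_div_mem_Icc hn hp hpn
  refine ⟨C, hC, fun f => ?_⟩
  obtain ⟨φ, hφ, hlim⟩ := exists_seq_hasCompactSupport_tendsto f
  have h1 : Tendsto (fun k => toL2 n (φ k)) atTop (𝓝 (toL2 n f)) :=
    ((toL2 n).continuous.tendsto f).comp hlim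
  have h2 : Tendsto (fun k => formNorm (φ k)) atTop (𝓝 (formNorm f)) :=
    (continuous_formNorm.tendsto f).comp hlim
  refine eLpNorm_le_ofReal_of_tendsto h1 (((h2.rpow_const (Or.inr hθ0)).const_mul C).mul
    (h1.norm.rpow_const (Or.inr (sub_nonneg.2 hθ1)))) fun k => ?_
  rw [eLpNorm_congr_ae (coeFn_toL2 (φ k))]
  exact h (φ k) (hφ k)

/-- The normalised excited states, as Schwartz functions. -/
def stateS (s : Multiset (Mode n)) : 𝓢(Fin n → ℂ, ℂ) :=
  ((‖toL2 n (excited s)‖⁻¹ : ℝ) : ℂ) • excited s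

lemma toL2_stateS (s : Multiset (Mode n)) : toL2 n (stateS s) = state s := map_smul _ _ _

lemma laplaceS_stateS (s : Multiset (Mode n)) :
    laplaceS n (stateS s) = (energy s : ℂ) • stateS s := by
  rw [stateS, map_smul, laplaceS_excited, smul_comm]

/-- The squared form norm of the partial sum is `∑ energy s · |⟪state s, u⟫|²`, and `energy s ·
|⟪state s, u⟫|² = |⟪state s, v⟫|²`; Bessel's inequality for `v` concludes. -/
theorem formNorm_sum_le {u v : L2 n} (h : HasSqrtImage u v) (F : Finset (Multiset (Mode n))) :
    formNorm (∑ s ∈ F, inner ℂ (state s) u • stateS s) ≤ ‖v‖ := by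
  set g := ∑ s ∈ F, inner ℂ (state s) u • stateS s
  refine Real.sqrt_le_iff.2 ⟨norm_nonneg _, ?_⟩
  refine le_trans (le_of_eq ?_) (orthonormal_state.sum_inner_products_le v (s := F))
  have h1 : toL2 n g = ∑ s ∈ F, inner ℂ (state s) u • state s := by
    simp only [g, map_sum, map_smul, toL2_stateS]
  have h2 : toL2 n (laplaceS n g) =
      ∑ s ∈ F, ((energy s : ℂ) * inner ℂ (state s) u) • state s := by
    simp only [g, map_sum, map_smul, laplaceS_stateS, toL2_stateS, smul_smul]
    refine Finset.sum_congr rfl fun s _ => ?_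
    rw [mul_comm]
  have h3 := inner_laplaceS_self g
  rw [h2, h1, orthonormal_state.inner_sum] at h3
  rw [← Complex.ofReal_inj, ← h3, Complex.ofReal_sum]
  refine Finset.sum_congr rfl fun s _ => ?_
  rw [hasSqrtImage_iff.1 h s, norm_mul, mul_pow, Complex.norm_real,
    Real.norm_of_nonneg (Real.sqrt_nonneg _), Real.sq_sqrt (energy_nonneg s), Complex.ofReal_mul,
    Complex.ofReal_pow, ← Complex.conj_mul']
  ring

theorem gnInequality (hn : 1 ≤ n) {p : ℝ} (hp : 1 ≤ p)
    (hpn : n = 1 ∨ (2 ≤ n ∧ p ≤ (n : ℝ) / ((n : ℝ) - 1))) :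
    GNInequality n p ((n : ℝ) * (p - 1) / p) := by
  obtain ⟨C, hC, h⟩ := exists_eLpNorm_le_schwartz hn hp hpn
  obtain ⟨hθ0, hθ1⟩ := mul_sub_one_div_mem_Icc hn hp hpn
  refine ⟨C, hC, fun u v huv => ?_⟩
  -- The semicontinuity lemma concerns sequences, so a cofinal sequence of finite index sets is
  -- extracted; the index type is countable.
  obtain ⟨F, hF⟩ := exists_seq_tendsto (atTop : Filter (Finset (Multiset (Mode n))))
  have hlim : Tendsto (fun k => ∑ s ∈ F k, inner ℂ (state s) u • state s) atTop (𝓝 u) := by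
    have h0 : Tendsto (fun F => ∑ s ∈ F, inner ℂ (state s) u • state s) atTop (𝓝 u) := by
      simpa only [HasSum, SummationFilter.unconditional_filter] using hasSum_state u
    exact h0.comp hF
  refine eLpNorm_le_ofReal_of_tendsto hlim
    ((hlim.norm.rpow_const (Or.inr (sub_nonneg.2 hθ1))).const_mul _) fun k => ?_
  have h1 : toL2 n (∑ s ∈ F k, inner ℂ (state s) u • stateS s) =
      ∑ s ∈ F k, inner ℂ (state s) u • state s := by
    simp only [map_sum, map_smul, toL2_stateS]
  have h2 := h (∑ s ∈ F k, inner ℂ (state s) u • stateS s)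
  rw [h1] at h2
  refine h2.trans (ENNReal.ofReal_le_ofReal ?_)
  have := formNorm_nonneg (∑ s ∈ F k, inner ℂ (state s) u • stateS s)
  gcongr
  exact formNorm_sum_le huv (F k)

/-! ### Necessity: concentrating Gaussians. -/

lemma integral_exp_neg_mul_absSq {b : ℝ} (hb : 0 < b) :
    ∫ z : Fin n → ℂ, Real.exp (-b * absSq z) = (Real.pi / b) ^ n := by
  have h1 : ∀ z : Fin n → ℂ, Real.exp (-b * absSq z) = ∏ j, Real.exp (-b * ‖z j‖ ^ 2) := fun z => by
    rw [absSq, Finset.mul_sum, Real.exp_sum]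
  simp_rw [h1]
  rw [integral_fintype_prod_volume_eq_pow (fun w : ℂ => Real.exp (-b * ‖w‖ ^ 2)), Fintype.card_fin,
    GaussianFourier.integral_rexp_neg_mul_sq_norm hb]
  simp [Complex.finrank_real_complex]

lemma powInt_gaussian {a q : ℝ} (ha : 0 < a) (hq : 0 < q) :
    powInt (gaussian n a ha) q = ENNReal.ofReal ((Real.pi / (a * q)) ^ n) := by
  have haq : 0 < a * q := mul_pos ha hq
  have hint : Integrable fun z : Fin n → ℂ => Real.exp (-(a * q) * absSq z) := by
    refine ((gaussian n (a * q) haq).integrable (μ := volume)).re.congr (ae_of_all _ fun z => ?_)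
    exact Complex.ofReal_re _
  rw [← integral_exp_neg_mul_absSq haq,
    ofReal_integral_eq_lintegral_ofReal hint (ae_of_all _ fun z => (Real.exp_pos _).le), powInt]
  refine lintegral_congr fun z => ?_
  rw [gaussian_apply, ← ofReal_norm, Complex.norm_real, Real.norm_of_nonneg (Real.exp_pos _).le,
    ENNReal.ofReal_rpow_of_pos (Real.exp_pos _), ← Real.exp_mul]
  congr 2
  ring

lemma eLpNorm_gaussian {a q : ℝ} (ha : 0 < a) (hq : 0 < q) :
    eLpNorm (toL2 n (gaussian n a ha)) (ENNReal.ofReal q) volume =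
      ENNReal.ofReal ((Real.pi / (a * q)) ^ (n / q)) := by
  have := Real.pi_pos
  rw [eLpNorm_congr_ae (coeFn_toL2 _), eLpNorm_eq_powInt _ hq, powInt_gaussian ha hq,
    ENNReal.ofReal_rpow_of_nonneg (by positivity) (by positivity), ← Real.rpow_natCast,
    ← Real.rpow_mul (by positivity)]
  congr 2
  ring

lemma norm_toL2_gaussian {a : ℝ} (ha : 0 < a) :
    ‖toL2 n (gaussian n a ha)‖ = (Real.pi / (a * 2)) ^ (n / 2 : ℝ) := by
  have := Real.pi_pos
  have h := eLpNorm_gaussian (n := n) ha two_pos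
  rw [ENNReal.ofReal_ofNat] at h
  rw [Lp.norm_def, h, ENNReal.toReal_ofReal (by positivity)]

/-- Half of the Gaussian absorbs the coordinate factor, `√a ‖z_j‖ ≤ exp (a|z|²/2)`, so only the norm
of a Gaussian remains to be computed. -/
lemma norm_toL2_le_of_gaussian_bound {a : ℝ} (ha : 0 < a) (ha2 : 0 < a / 2) (j : Fin n)
    {f : 𝓢(Fin n → ℂ, ℂ)} (hf : ∀ z, ‖f z‖ ≤ 2 * a * (‖z j‖ * ‖gaussian n a ha z‖)) :
    ‖toL2 n f‖ ≤ 2 * √a * ‖toL2 n (gaussian n (a / 2) ha2)‖ := by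
  have hs : 0 < √a := Real.sqrt_pos.2 ha
  refine Lp.norm_le_mul_norm_of_ae_le_mul ?_
  filter_upwards [coeFn_toL2 f, coeFn_toL2 (gaussian n (a / 2) ha2)] with z h1 h2
  rw [h1, h2]
  refine (hf z).trans ?_
  rw [gaussian_apply, gaussian_apply, Complex.norm_real, Complex.norm_real,
    Real.norm_of_nonneg (Real.exp_pos _).le, Real.norm_of_nonneg (Real.exp_pos _).le]
  have h3 : √a * ‖z j‖ ≤ Real.exp (a / 2 * absSq z) := by
    have h4 : ‖z j‖ ^ 2 ≤ absSq z := Finset.single_le_sum (f := fun j => ‖z j‖ ^ 2)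
      (fun _ _ => by positivity) (Finset.mem_univ j)
    refine le_trans ?_ (Real.add_one_le_exp _)
    have h5 : √a ^ 2 = a := Real.sq_sqrt ha.le
    nlinarith [_root_.sq_nonneg (√a * ‖z j‖ - 1)]
  calc 2 * a * (‖z j‖ * Real.exp (-a * absSq z))
      = 2 * √a * ((√a * ‖z j‖) * Real.exp (-a * absSq z)) := by
        nth_rw 1 [← Real.mul_self_sqrt ha.le]; ring
    _ ≤ 2 * √a * (Real.exp (a / 2 * absSq z) * Real.exp (-a * absSq z)) := by gcongr
    _ = 2 * √a * Real.exp (-(a / 2) * absSq z) := by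
        rw [← Real.exp_add]; congr 2; ring

lemma formNorm_gaussian_le {a : ℝ} (ha : 1 ≤ a) (ha0 : 0 < a) :
    formNorm (gaussian n a ha0) ≤
      (√(8 * n) * Real.pi ^ (n / 2 : ℝ)) * a ^ ((1 - n) / 2 : ℝ) := by
  have hpi := Real.pi_pos
  have ha2 : 0 < a / 2 := by linarith
  have hA : ∀ j, ‖toL2 n (ann (Sum.inl j) (gaussian n a ha0))‖ ≤
      2 * √a * ‖toL2 n (gaussian n (a / 2) ha2)‖ := fun j => by
    refine norm_toL2_le_of_gaussian_bound ha0 ha2 j fun z => ?_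
    rw [ann_gaussian_inl, norm_mul, norm_mul, RCLike.norm_conj, mul_assoc]
    gcongr
    have : ‖((1 / 2 - a : ℝ) : ℂ)‖ ≤ 2 * a := by
      rw [Complex.norm_real, Real.norm_eq_abs, abs_le]
      constructor <;> linarith
    simpa using this
  have hC : ∀ j, ‖toL2 n (cre (Sum.inl j) (gaussian n a ha0))‖ ≤
      2 * √a * ‖toL2 n (gaussian n (a / 2) ha2)‖ := fun j => by
    refine norm_toL2_le_of_gaussian_bound ha0 ha2 j fun z => ?_
    rw [cre_gaussian_inl, norm_mul, norm_mul, mul_assoc]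
    gcongr
    have : ‖((1 / 2 + a : ℝ) : ℂ)‖ ≤ 2 * a := by
      rw [Complex.norm_real, Real.norm_eq_abs, abs_le]
      constructor <;> linarith
    simpa using this
  rw [norm_toL2_gaussian ha2, div_mul_cancel₀ _ two_ne_zero] at hA hC
  set X := 2 * √a * (Real.pi / a) ^ (n / 2 : ℝ) with hX
  have hX0 : 0 ≤ X := by positivity
  have h1 : formNorm (gaussian n a ha0) ≤ √(2 * n) * X := by
    rw [← Real.sqrt_sq hX0, ← Real.sqrt_mul (by positivity)]
    refine Real.sqrt_le_sqrt ?_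
    calc _ ≤ ∑ _j : Fin n, (X ^ 2 + X ^ 2) := by
          gcongr with j
          · exact hA j
          · exact hC j
      _ = 2 * n * X ^ 2 := by
          rw [Finset.sum_const, Finset.card_univ, Fintype.card_fin, nsmul_eq_mul]; ring
  refine h1.trans (le_of_eq ?_)
  have h2 : √(8 * n : ℝ) = 2 * √(2 * n) := by
    rw [show (8 * n : ℝ) = 2 ^ 2 * (2 * n) by ring, Real.sqrt_mul (by positivity),
      Real.sqrt_sq zero_le_two]
  have h3 : (Real.pi / a) ^ (n / 2 : ℝ) = Real.pi ^ (n / 2 : ℝ) * a ^ (-(n / 2) : ℝ) := by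
    rw [Real.div_rpow hpi.le ha0.le, Real.rpow_neg ha0.le, div_eq_mul_inv]
  have h4 : a ^ ((1 - n) / 2 : ℝ) = √a * a ^ (-(n / 2) : ℝ) := by
    rw [Real.sqrt_eq_rpow, ← Real.rpow_add ha0]
    congr 1
    ring
  rw [hX, h2, h3, h4]
  ring

theorem GNInequality.le_of_two_le (hn : 2 ≤ n) {p θ : ℝ} (hp : 1 ≤ p) (hθ0 : 0 ≤ θ) (hθ1 : θ ≤ 1)
    (h : GNInequality n p θ) : p ≤ (n : ℝ) / ((n : ℝ) - 1) := by
  obtain ⟨C, hC, h⟩ := h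
  have hpi := Real.pi_pos
  have hp0 : 0 < p := by linarith
  have hn' : (2 : ℝ) ≤ n := by exact_mod_cast hn
  have hn0 : (0 : ℝ) < n := by linarith
  have hn1 : (0 : ℝ) < n - 1 := by linarith
  -- The net power of `a` after both sides of the inequality are evaluated on `exp (-a|z|²)`; a
  -- positive `α` is impossible as `a → ∞`.
  set α : ℝ := (n - θ) / 2 - n / (2 * p) with hα
  set c : ℝ := √(8 * n) * Real.pi ^ (n / 2 : ℝ)
  have hc : 0 < c := by positivity
  set d : ℝ := (Real.pi / (2 * p)) ^ (n / (2 * p))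
  have hd : 0 < d := by positivity
  set e : ℝ := (Real.pi / 2) ^ (n / 2 : ℝ)
  have he : 0 < e := by positivity
  have hbound : ∀ a : ℝ, 1 ≤ a → a ^ α ≤ C * c ^ θ * e ^ (1 - θ) / d := by
    intro a ha
    have ha0 : 0 < a := by linarith
    obtain ⟨v, hv, hvn⟩ := exists_hasSqrtImage (gaussian n a ha0)
    have hv' : ‖v‖ = formNorm (gaussian n a ha0) := by
      rw [formNorm, ← hvn, Real.sqrt_sq (norm_nonneg _)]
    have h1 := h _ v hv
    rw [eLpNorm_gaussian ha0 (by linarith : 0 < 2 * p), ENNReal.ofReal_le_ofReal_iff (by positivity),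
      hv', norm_toL2_gaussian ha0] at h1
    have h2 : (Real.pi / (a * (2 * p))) ^ ((n : ℝ) / (2 * p)) = d * a ^ (-(n / (2 * p)) : ℝ) := by
      rw [mul_comm a, ← div_div, Real.div_rpow (by positivity) ha0.le, Real.rpow_neg ha0.le,
        div_eq_mul_inv]
    have h3 : ((Real.pi / (a * 2)) ^ (n / 2 : ℝ)) ^ (1 - θ) =
        e ^ (1 - θ) * a ^ (-(n / 2) * (1 - θ) : ℝ) := by
      rw [mul_comm a, ← div_div, Real.div_rpow (by positivity) ha0.le, div_eq_mul_inv,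
        ← Real.rpow_neg ha0.le, Real.mul_rpow (by positivity) (by positivity),
        ← Real.rpow_mul ha0.le]
    have h4 : formNorm (gaussian n a ha0) ^ θ ≤ c ^ θ * a ^ ((1 - n) / 2 * θ : ℝ) := by
      rw [Real.rpow_mul ha0.le, ← Real.mul_rpow hc.le (by positivity)]
      exact Real.rpow_le_rpow (formNorm_nonneg _) (formNorm_gaussian_le ha ha0) hθ0
    rw [h2, h3] at h1
    have h5 : d * a ^ (-(n / (2 * p)) : ℝ) ≤ C * (c ^ θ * a ^ ((1 - n) / 2 * θ : ℝ)) *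
        (e ^ (1 - θ) * a ^ (-(n / 2) * (1 - θ) : ℝ)) := h1.trans (by gcongr)
    have h6 : a ^ ((1 - n) / 2 * θ : ℝ) * a ^ (-(n / 2) * (1 - θ) : ℝ) = a ^ (-((n - θ) / 2)) := by
      rw [← Real.rpow_add ha0]
      congr 1
      ring
    have h7 : a ^ α = a ^ (-(n / (2 * p)) : ℝ) * a ^ ((n - θ) / 2) := by
      rw [← Real.rpow_add ha0]
      congr 1
      ring
    have h8 : a ^ (-((n - θ) / 2)) * a ^ ((n - θ) / 2) = 1 := by
      rw [← Real.rpow_add ha0, neg_add_cancel, Real.rpow_zero]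
    rw [le_div_iff₀ hd, h7]
    calc _ = d * a ^ (-(n / (2 * p)) : ℝ) * a ^ ((n - θ) / 2) := by ring
      _ ≤ C * (c ^ θ * a ^ ((1 - n) / 2 * θ : ℝ)) *
        (e ^ (1 - θ) * a ^ (-(n / 2) * (1 - θ) : ℝ)) * a ^ ((n - θ) / 2) := by gcongr
      _ = C * c ^ θ * e ^ (1 - θ) * ((a ^ ((1 - n) / 2 * θ : ℝ) * a ^ (-(n / 2) * (1 - θ) : ℝ)) *
          a ^ ((n - θ) / 2)) := by ring
      _ = _ := by rw [h6, h8, mul_one]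
  have hα0 : α ≤ 0 := by
    by_contra! hpos
    obtain ⟨a, ha1, ha2⟩ := (((tendsto_rpow_atTop hpos).eventually_gt_atTop
      (C * c ^ θ * e ^ (1 - θ) / d)).and (eventually_ge_atTop 1)).exists
    exact (hbound a ha2).not_gt ha1
  rw [le_div_iff₀ hn1]
  -- From `α ≤ 0` and `θ ≤ 1`.
  have h9 : (n - 1) / 2 ≤ n / (2 * p) := by linarith
  rw [div_le_div_iff₀ two_pos (by positivity)] at h9
  linarith

end Landau

end

theorem mainTheorem5 (n : ℕ) (hn : 1 ≤ n) :
    (∀ p : ℝ, Landau.GNAdmissible n p ↔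
      1 ≤ p ∧ (n = 1 ∨ (2 ≤ n ∧ p ≤ (n : ℝ) / ((n : ℝ) - 1)))) ∧
    (∀ p : ℝ, 1 ≤ p → (n = 1 ∨ (2 ≤ n ∧ p ≤ (n : ℝ) / ((n : ℝ) - 1))) →
      Landau.GNInequality n p ((n : ℝ) * (p - 1) / p)) ∧
    IsLeast (Landau.eigenvalues n) (n : ℝ) ∧
    (∀ R : ℝ, (Landau.eigenvalues n ∩ Set.Iic R).Finite) ∧
    (∀ μ ∈ Landau.eigenvalues n, ¬ FiniteDimensional ℂ (Landau.eigenspace n μ)) ∧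
    (∃ (e : HilbertBasis ℕ ℂ (Landau.L2 n)) (lam : ℕ → ℝ),
      ∀ k : ℕ, e k ∈ Landau.eigenspace n (lam k)) := by
  refine ⟨fun p => ⟨fun h => ?_, fun h => ?_⟩, fun p hp hpn => Landau.gnInequality hn hp hpn,
    Landau.isLeast_eigenvalues, Landau.finite_eigenvalues_inter,
    fun μ hμ => Landau.not_finiteDimensional_eigenspace hn hμ,
    Landau.exists_hilbertBasis_eigenspace hn⟩
  · obtain ⟨hp, θ, hθ0, hθ1, hGN⟩ := h
    refine ⟨hp, ?_⟩
    rcases hn.eq_or_lt with h1 | h1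
    · exact Or.inl h1.symm
    · exact Or.inr ⟨h1, hGN.le_of_two_le h1 hp hθ0 hθ1⟩
  · obtain ⟨hp, hpn⟩ := h
    obtain ⟨hθ0, hθ1⟩ := Landau.mul_sub_one_div_mem_Icc hn hp hpn
    exact ⟨hp, _, hθ0, hθ1, Landau.gnInequality hn hp hpn⟩
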